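/- A generalised reachability game $\mathcal G=(\mathcal A,s,\mathcal F)$ consists of an arena $\mathcal A$ (a finite directed graph $(V,E)$ in which every vertex has a successor, together with a partition $V=V_{\mathsf{Eve}}\sqcup V_{\mathsf{Adam}}$), a start vertex $s\in V$, and a finite family $\mathcal F=\{F_1,\dots,F_r\}$ of target sets $F_i\subseteq V$. A strategy of player $p$ is a function $\sigma_p:V^*\cdot V_p\to V$ such that $\sigma_p(v_0\dots v_k)$ is always a successor of $v_k$; a pair of strategies induces a unique infinite play $v_0v_1v_2\dots$ with $v_0=s$. Eve wins $\mathcal G$ if she has a strategy such that, against every strategy of Adam, there is a $k$ such that $\{v_0,\dots,v_k\}$ meets every $F_i$. $\mathsf{GenReach}$ is the problem of deciding, given $\mathcal G$, whether Eve wins $\mathcal G$. A game with vertex set $\{0,\dots,n-1\}$ is represented by the word $\langle\mathcal G\rangle$ over $\{0,1,\#\}$ that lists the owners of the vertices, the indicator vector of $s$, the rows of the adjacency matrix, and the characteristic vectors of the target sets, each of these bit vectors of length $n$ being followed by $\#$; the size $|\mathcal G|$ of the game is the length of this word. Theorem. $\mathsf{GenReach}$ is in $\mathrm P$ when the number of target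 sets that are not singletons is logarithmic in the size of the game. Precisely: (1) for every $c\in\mathbb N$, the language of all words $\langle\mathcal G\rangle$ such that at most $c\lfloor\log_2|\mathcal G|\rfloor$ of the target sets of $\mathcal G$ are not singletons and Eve wins $\mathcal G$ is in $\mathrm P$; (2) for every function $k:\mathbb N\to\mathbb N$ with $k(N)=O(\log N)$ there is a language $L\in\mathrm P$ such that, for every game $\mathcal G$ in which at most $k(|\mathcal G|)$ target sets are not singletons, $\langle\mathcal G\rangle\in L$ if and only if Eve wins $\mathcal G$. Here $\mathrm P$ is the class of languages decided by a (multi-stack) Turing machine that halts on every word within a number of steps polynomial in the length of the word. -/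

import Mathlib

namespace GenReach

/-- The two players. -/
inductive Player where
  | eve
  | adam

/-- The bit that records the owner of a vertex. -/
def Player.toBit : Player → Bool
  | .eve => true
  | .adam => false

/-- A game arena: a directed graph on `V` whose vertices are partitioned between the two players.
Every vertex has a successor, so that plays can always be continued. -/
structure Arena (V : Type) where
  /-- the edge relation `E ⊆ V × V` -/
  edges : Finset (V × V)
  /-- the player who controls a vertex -/
  owner : V → Player
  /-- there are no dead ends -/
  exists_succ : ∀ v, ∃ w, (v, w) ∈ edges

/-- A generalised reachability game: an arena, a start vertex, and a finite family
`F₁, …, Fᵣ` of target sets (a set of target sets is a family without repetitions). -/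
structure Game (V : Type) extends Arena V where
  /-- the start vertex -/
  start : V
  /-- the target sets -/
  targets : List (Finset V)

/-- A strategy for player `p`, a function `V* · V_p → V` that always chooses a successor of the
current vertex. The first argument is the past, the second one the current vertex; the values at
vertices of the other player are never used. -/
structure Strategy {V : Type} (A : Arena V) (p : Player) where
  /-- the vertex to which the token is moved -/
  move : List V → V → V
  /-- the chosen vertex is a successor of the current one -/
  legal : ∀ (past : List V) (v : V), A.owner v = p → (v, move past v) ∈ A.edges

namespace Game

variable {V : Type} (G : Game V)

/-- The vertex chosen by the owner of `v` after the history `past · v`. -/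
def next (σ : Strategy G.toArena .eve) (τ : Strategy G.toArena .adam) (past : List V) (v : V) : V :=
  match G.owner v with
  | .eve => σ.move past v
  | .adam => τ.move past v

/-- The past and the current vertex after `i` moves. -/
def history (σ : Strategy G.toArena .eve) (τ : Strategy G.toArena .adam) : ℕ → List V × V
  | 0 => ([], G.start)
  | i + 1 =>
    ((history σ τ i).1 ++ [(history σ τ i).2], G.next σ τ (history σ τ i).1 (history σ τ i).2)

/-- The infinite play induced by a pair of strategies. -/
def play (σ : Strategy G.toArena .eve) (τ : Strategy G.toArena .adam) (i : ℕ) : V :=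
  (G.history σ τ i).2

/-- Eve has a strategy that, against every strategy of Adam, visits every target set within
finitely many moves. -/
def EveWins : Prop :=
  ∃ σ : Strategy G.toArena .eve, ∀ τ : Strategy G.toArena .adam,
    ∃ k : ℕ, ∀ F ∈ G.targets, ∃ j ≤ k, G.play σ τ j ∈ F

/-- The number of target sets that are not singletons. -/
def numNonSingleton : ℕ :=
  (G.targets.filter (fun F => F.card ≠ 1)).length

/-- The rows of bits that describe a game with vertex set `{0, …, n - 1}`: the owners, the start
vertex, the rows of the adjacency matrix, and the characteristic vectors of the target sets. -/
def rows {n : ℕ} (G : Game (Fin n)) : List (List Bool) :=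
  List.ofFn (fun v => (G.owner v).toBit) ::
  List.ofFn (fun v => decide (v = G.start)) ::
  (List.ofFn (fun u => List.ofFn (fun v => decide ((u, v) ∈ G.edges))) ++
    G.targets.map (fun F => List.ofFn (fun v => decide (v ∈ F))))

/-- The word that represents a game: its rows, each followed by the separator `none`. -/
def encode {n : ℕ} (G : Game (Fin n)) : List (Option Bool) :=
  G.rows.flatMap (fun r => r.map some ++ [none])

/-- The size of a game, the length of the word that represents it. -/
def size {n : ℕ} (G : Game (Fin n)) : ℕ :=
  G.encode.length

end Game

open Classical in
/-- The complexity class P: the languages over a finite alphabet whose membership problem is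
decided by a Turing machine that halts on every word within a number of steps that is polynomial
in the length of the word. -/
def InP {Γ : Type} [Fintype Γ] (L : Language Γ) : Prop :=
  Nonempty (Turing.TM2ComputableInPolyTime (id : List Γ → List Γ) Computability.encodeBool
    (fun w => decide (w ∈ L)))

/-- The generalised reachability problem for games of size `N` that have at most `c * log₂ N`
target sets that are not singletons. -/
def logLanguage (c : ℕ) : Language (Option Bool) :=
  {w | ∃ (n : ℕ) (G : Game (Fin n)), w = G.encode ∧
    G.numNonSingleton ≤ c * Nat.log 2 G.size ∧ G.EveWins}

end GenReach

/-! The current vertex together with the targets not yet visited determines the rest of the game, so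
generalised reachability is a plain reachability game (`Game.eveWins_iff`), solvable by backward
iteration but with exponentially many positions. The at most `c * log N` non-singletons contribute
only about `N ^ c` subfamilies. The singletons are the difficulty: one has to show that few sets of
remaining singletons matter.

Write u → v if Eve can force a visit to v from u; this is a preorder. If a play that follows a
winning strategy arrives at a remaining singleton w, then Eve still wins from there, so w → q for
every remaining q. At such a w Eve may moreover collect each remaining u with u → w at no cost, by
going to u and back to w. So after a visit to w the set of remaining singletons may be replaced by
those u for which u → w fails, and this set depends on w alone. In the resulting game `reachChain`
the singleton component takes at most n + 1 values. The equivalence is `reachAll_iff_reachChain`: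
`reachAll_of_reachChain` turns each removal of singletons into a round trip (`reachAll_tour`), and
`reachChain_of_reachAll` follows a winning strategy under the invariant `ChainInv`, that singletons
no longer listed force all listed ones.

Hence `solve` runs on polynomially many positions, and `decideB_iff` identifies the procedure with
the language. For the time bound, all data are binary trees and `Poly` means computed by a stack
program in polynomial time. `Poly` is closed under composition, pairing, branching, and folds whose
intermediate values stay polynomially small; this gives `Poly.decideB`. Programs compile to Turing
machines in `Exec.run` and `InP.of_poly_reverse`.

For part (2), a bound O(log N) is at most `c * Nat.log 2 N` for some c and all N ≥ 2, and every game
has size at least 2, so the language of part (1) serves. -/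

namespace GenReach

/-! ### Stack programs and their compilation to multi-stack Turing machines -/

/-- The working stacks: the value stack `r`, the stack `a` of loop counters, and three scratch
stacks. -/
inductive Reg where
  | r | a | b | c | d
  deriving DecidableEq

instance : Fintype Reg :=
  ⟨{.r, .a, .b, .c, .d}, fun k => by cases k <;> simp⟩

/-- The contents of the working stacks. -/
structure Store where
  r : List Bool
  a : List Bool
  b : List Bool
  c : List Bool
  d : List Bool

namespace Store

/-- The contents of one stack. -/
def get : Reg → Store → List Bool
  | .r, s => s.r
  | .a, s => s.a
  | .b, s => s.b
  | .c, s => s.c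
  | .d, s => s.d

/-- Replace the contents of one stack. -/
def set : Reg → List Bool → Store → Store
  | .r, l, s => { s with r := l }
  | .a, l, s => { s with a := l }
  | .b, l, s => { s with b := l }
  | .c, l, s => { s with c := l }
  | .d, l, s => { s with d := l }

end Store

/-- Structured programs over the working stacks. -/
inductive Prog where
  /-- do nothing -/
  | skip
  /-- push a bit -/
  | push (k : Reg) (x : Bool)
  /-- sequential composition -/
  | seq (p q : Prog)
  /-- pop a bit and branch -/
  | cases (k : Reg) (p q : Prog)
  /-- pop a bit; leave the loop if there is none; run the first body on `true` and the second one on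
  `false`, after which the loop is left unless `e` is set -/
  | loop (k : Reg) (e : Bool) (p q : Prog)

/-- `Exec p s t s'`: the program `p` transforms the store `s` into `s'` in `t` steps. -/
inductive Exec : Prog → Store → ℕ → Store → Prop
  | skip (s) : Exec .skip s 1 s
  | push (k x s) : Exec (.push k x) s 1 (s.set k (x :: s.get k))
  | seq {p q s t s' t' s''} : Exec p s t s' → Exec q s' t' s'' → Exec (.seq p q) s (t + t') s''
  | casesTrue {k p q s l t s'} : s.get k = true :: l → Exec p (s.set k l) t s' →
      Exec (.cases k p q) s (1 + t) s'
  | casesFalse {k p q s l t s'} : s.get k = false :: l → Exec q (s.set k l) t s' →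
      Exec (.cases k p q) s (1 + t) s'
  | loopNil {k e p q s} : s.get k = [] → Exec (.loop k e p q) s 1 s
  | loopTrue {k e p q s l t s' t' s''} : s.get k = true :: l → Exec p (s.set k l) t s' →
      Exec (.loop k e p q) s' t' s'' → Exec (.loop k e p q) s (1 + t + t') s''
  | loopFalse {k p q s l t s' t' s''} : s.get k = false :: l → Exec q (s.set k l) t s' →
      Exec (.loop k true p q) s' t' s'' → Exec (.loop k true p q) s (1 + t + t') s''
  | loopExit {k p q s l t s'} : s.get k = false :: l → Exec q (s.set k l) t s' →
      Exec (.loop k false p q) s (1 + t) s'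

namespace Prog

/-- The positions of a program. -/
def Lab : Prog → Type
  | skip => Unit
  | push _ _ => Unit
  | seq p q => p.Lab ⊕ q.Lab
  | cases _ p q => Unit ⊕ (p.Lab ⊕ q.Lab)
  | loop _ _ p q => Unit ⊕ (p.Lab ⊕ q.Lab)

/-- A program has finitely many positions. -/
@[reducible]
def fintypeLab : (p : Prog) → Fintype p.Lab
  | skip => inferInstanceAs (Fintype Unit)
  | push _ _ => inferInstanceAs (Fintype Unit)
  | seq p q => @instFintypeSum _ _ p.fintypeLab q.fintypeLab
  | cases _ p q =>
    @instFintypeSum _ _ _ (@instFintypeSum _ _ p.fintypeLab q.fintypeLab)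
  | loop _ _ p q =>
    @instFintypeSum _ _ _ (@instFintypeSum _ _ p.fintypeLab q.fintypeLab)

instance (p : Prog) : Fintype p.Lab := p.fintypeLab

/-- The initial position. -/
def entry : (p : Prog) → p.Lab
  | skip => ()
  | push _ _ => ()
  | seq p _ => .inl p.entry
  | cases _ _ _ => .inl ()
  | loop _ _ _ _ => .inl ()

end Prog

/-- The stacks of a machine: the input stack `none`, and the working stacks. -/
def Stk : Option Reg → Type
  | none => Option Bool
  | some _ => Bool

/-- The last symbol that was read. -/
abbrev Last := Option (Option Bool)

/-- Statements of a machine with labels `Λ`. -/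
abbrev Stm (Λ : Type) := Turing.TM2.Stmt Stk Λ Last

/-- The contents of all stacks. -/
def tapes (i : List (Option Bool)) (s : Store) : (k : Option Reg) → List (Stk k)
  | none => i
  | some k => s.get k

open Turing.TM2.Stmt

/-- Pop from a working stack and store the bit. -/
def popBit {Λ : Type} (k : Reg) (q : Stm Λ) : Stm Λ :=
  pop (some k) (fun _ x => x.map (fun y : Bool => some y)) q

/-- The machine code of a program. -/
def Prog.code {Λ : Type} : (p : Prog) → (emb : p.Lab → Λ) → (exit : Λ) → p.Lab → Stm Λ
  | skip, _, exit, _ => goto fun _ => exit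
  | push k x, _, exit, _ => Turing.TM2.Stmt.push (some k) (fun _ => x) (goto fun _ => exit)
  | seq p q, emb, exit, l => match l with
    | .inl l => p.code (fun l => emb (.inl l)) (emb (.inr q.entry)) l
    | .inr l => q.code (fun l => emb (.inr l)) exit l
  | cases k p q, emb, exit, l => match l with
    | .inl _ => popBit k (goto fun v =>
        if v = some (some true) then emb (.inr (.inl p.entry)) else emb (.inr (.inr q.entry)))
    | .inr (.inl l) => p.code (fun l => emb (.inr (.inl l))) exit l
    | .inr (.inr l) => q.code (fun l => emb (.inr (.inr l))) exit l
  | loop k e p q, emb, exit, l => match l with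
    | .inl _ => popBit k (goto fun v =>
        if v = some (some true) then emb (.inr (.inl p.entry)) else
        if v = some (some false) then emb (.inr (.inr q.entry)) else exit)
    | .inr (.inl l) => p.code (fun l => emb (.inr (.inl l))) (emb (.inl ())) l
    | .inr (.inr l) =>
      q.code (fun l => emb (.inr (.inr l))) (if e then emb (.inl ()) else exit) l

/-! ### Correctness of the compilation of stack programs. -/

theorem tapes_push (i : List (Option Bool)) (s : Store) (k : Reg) (l : List Bool) :
    Function.update (tapes i s) (some k) l = tapes i (s.set k l) := by
  funext j
  rcases j with _ | j
  · rfl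
  · cases k <;> cases j <;> rfl

theorem tapes_input (i j : List (Option Bool)) (s : Store) :
    Function.update (tapes i s) none j = tapes j s := by
  funext k
  rcases k with _ | k <;> rfl

theorem Store.set_get (s : Store) (k : Reg) : s.set k (s.get k) = s := by
  cases k <;> rfl

section Run

variable {Λ : Type} (m : Λ → Stm Λ)

/-- `Run m c t c'`: the machine `m` goes from `c` to `c'` in `t` steps. -/
def Run (c : Turing.TM2.Cfg Stk Λ Last) (t : ℕ) (c' : Turing.TM2.Cfg Stk Λ Last) : Prop :=
  (flip bind (Turing.TM2.step m))^[t] (some c) = some c'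

variable {m}

theorem Run.trans {c₁ c₂ c₃ : Turing.TM2.Cfg Stk Λ Last} {t t' : ℕ} (h : Run m c₁ t c₂)
    (h' : Run m c₂ t' c₃) : Run m c₁ (t + t') c₃ := by
  unfold Run at *
  rw [add_comm, Function.iterate_add_apply, h, h']

theorem Run.step {l : Λ} {q : Stm Λ} (h : m l = q) (v : Last)
    (S : (k : Option Reg) → List (Stk k)) :
    Run m ⟨some l, v, S⟩ 1 (Turing.TM2.stepAux q v S) := h ▸ rfl

theorem stepAux_popBit (k : Reg) (q : Stm Λ) (v : Last) (i : List (Option Bool)) (s : Store) :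
    Turing.TM2.stepAux (popBit k q) v (tapes i s) =
      Turing.TM2.stepAux q ((s.get k).head?.map some) (tapes i (s.set k (s.get k).tail)) := by
  rw [← tapes_push]
  rfl

theorem stepAux_popBit_cons {k : Reg} (q : Stm Λ) (v : Last) (i : List (Option Bool)) {s : Store}
    {x : Bool} {l : List Bool} (h : s.get k = x :: l) :
    Turing.TM2.stepAux (popBit k q) v (tapes i s) =
      Turing.TM2.stepAux q (some (some x)) (tapes i (s.set k l)) := by
  rw [stepAux_popBit, h]
  rfl

theorem stepAux_popBit_nil {k : Reg} (q : Stm Λ) (v : Last) (i : List (Option Bool)) {s : Store}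
    (h : s.get k = []) :
    Turing.TM2.stepAux (popBit k q) v (tapes i s) =
      Turing.TM2.stepAux q none (tapes i s) := by
  have := stepAux_popBit k q v i s
  rw [h] at this
  rw [this]
  have h2 : s.set k [] = s := by rw [← h, s.set_get]
  simp [h2]

/-- The embedding and the exit label are arbitrary because the induction meets sub-programs inside a
larger machine, whose exit may be the entry of the next program or the head of an enclosing loop.
Every construct costs exactly as many machine steps as `Exec` counts. -/
theorem Exec.run {p : Prog} {s s' : Store} {t : ℕ} (h : Exec p s t s') (i : List (Option Bool)) :
    ∀ (emb : p.Lab → Λ) (exit : Λ), (∀ l, m (emb l) = p.code emb exit l) → ∀ v, ∃ v',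
      Run m ⟨some (emb p.entry), v, tapes i s⟩ t ⟨some exit, v', tapes i s'⟩ := by
  induction h with
  | skip s =>
    intro emb exit hm v
    refine ⟨v, ?_⟩
    exact Run.step (hm ()) v (tapes i s)
  | push k x s =>
    intro emb exit hm v
    refine ⟨v, ?_⟩
    rw [← tapes_push]
    exact Run.step (hm ()) v (tapes i s)
  | seq _ _ ih₁ ih₂ =>
    intro emb exit hm v
    obtain ⟨v₁, h₁⟩ := ih₁ (fun l => emb (.inl l)) _ (fun l => hm (.inl l)) v
    obtain ⟨v₂, h₂⟩ := ih₂ (fun l => emb (.inr l)) _ (fun l => hm (.inr l)) v₁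
    exact ⟨v₂, h₁.trans h₂⟩
  | @casesTrue k p q s l t s' hk _ ih =>
    intro emb exit hm v
    obtain ⟨v₁, h₁⟩ := ih (fun l => emb (.inr (.inl l))) _ (fun l => hm (.inr (.inl l)))
      (some (some true))
    refine ⟨v₁, Run.trans ?_ h₁⟩
    have := Run.step (hm (Prog.entry _)) v (tapes i s)
    simp only [Prog.code, Prog.entry, stepAux_popBit_cons _ _ _ hk] at this
    exact this
  | @casesFalse k p q s l t s' hk _ ih =>
    intro emb exit hm v
    obtain ⟨v₁, h₁⟩ := ih (fun l => emb (.inr (.inr l))) _ (fun l => hm (.inr (.inr l)))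
      (some (some false))
    refine ⟨v₁, Run.trans ?_ h₁⟩
    have := Run.step (hm (Prog.entry _)) v (tapes i s)
    simp only [Prog.code, Prog.entry, stepAux_popBit_cons _ _ _ hk] at this
    exact this
  | @loopNil k e p q s hk =>
    intro emb exit hm v
    refine ⟨none, ?_⟩
    have := Run.step (hm (Prog.entry _)) v (tapes i s)
    simp only [Prog.code, Prog.entry, stepAux_popBit_nil _ _ _ hk] at this
    exact this
  | @loopTrue k e p q s l t s' t' s'' hk _ _ ih₁ ih₂ =>
    intro emb exit hm v
    obtain ⟨v₁, h₁⟩ := ih₁ (fun l => emb (.inr (.inl l))) _ (fun l => hm (.inr (.inl l)))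
      (some (some true))
    obtain ⟨v₂, h₂⟩ := ih₂ emb exit hm v₁
    refine ⟨v₂, Run.trans (Run.trans ?_ h₁) h₂⟩
    have := Run.step (hm (Prog.entry _)) v (tapes i s)
    simp only [Prog.code, Prog.entry, stepAux_popBit_cons _ _ _ hk] at this
    exact this
  | @loopFalse k p q s l t s' t' s'' hk _ _ ih₁ ih₂ =>
    intro emb exit hm v
    obtain ⟨v₁, h₁⟩ := ih₁ (fun l => emb (.inr (.inr l))) _ (fun l => hm (.inr (.inr l)))
      (some (some false))
    obtain ⟨v₂, h₂⟩ := ih₂ emb exit hm v₁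
    refine ⟨v₂, Run.trans (Run.trans ?_ h₁) h₂⟩
    have := Run.step (hm (Prog.entry _)) v (tapes i s)
    simp only [Prog.code, Prog.entry, stepAux_popBit_cons _ _ _ hk] at this
    exact this
  | @loopExit k p q s l t s' hk _ ih =>
    intro emb exit hm v
    obtain ⟨v₁, h₁⟩ := ih (fun l => emb (.inr (.inr l))) _ (fun l => hm (.inr (.inr l)))
      (some (some false))
    refine ⟨v₁, Run.trans ?_ h₁⟩
    have := Run.step (hm (Prog.entry _)) v (tapes i s)
    simp only [Prog.code, Prog.entry, stepAux_popBit_cons _ _ _ hk] at this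
    exact this

end Run

/-! ### Running programs within a time bound -/

/-- `p` transforms `s` into `s'` in at most `n` steps. -/
def Within (p : Prog) (s : Store) (n : ℕ) (s' : Store) : Prop :=
  ∃ t ≤ n, Exec p s t s'

namespace Within

theorem mono {p : Prog} {s s' : Store} {n m : ℕ} (h : Within p s n s') (hnm : n ≤ m) :
    Within p s m s' := by
  obtain ⟨t, ht, h⟩ := h
  exact ⟨t, ht.trans hnm, h⟩

theorem skip (s : Store) : Within .skip s 1 s := ⟨1, le_rfl, .skip s⟩

theorem push (k : Reg) (x : Bool) (s : Store) : Within (.push k x) s 1 (s.set k (x :: s.get k)) :=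
  ⟨1, le_rfl, .push k x s⟩

theorem seq {p q : Prog} {s s' s'' : Store} {n m : ℕ} (h : Within p s n s')
    (h' : Within q s' m s'') : Within (.seq p q) s (n + m) s'' := by
  obtain ⟨t, ht, h⟩ := h
  obtain ⟨t', ht', h'⟩ := h'
  exact ⟨t + t', add_le_add ht ht', .seq h h'⟩

theorem casesTrue {k : Reg} {p q : Prog} {s s' : Store} {l : List Bool} {n : ℕ}
    (hk : s.get k = true :: l) (h : Within p (s.set k l) n s') :
    Within (.cases k p q) s (1 + n) s' := by
  obtain ⟨t, ht, h⟩ := h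
  exact ⟨1 + t, by omega, .casesTrue hk h⟩

theorem casesFalse {k : Reg} {p q : Prog} {s s' : Store} {l : List Bool} {n : ℕ}
    (hk : s.get k = false :: l) (h : Within q (s.set k l) n s') :
    Within (.cases k p q) s (1 + n) s' := by
  obtain ⟨t, ht, h⟩ := h
  exact ⟨1 + t, by omega, .casesFalse hk h⟩

theorem loopNil {k : Reg} {e : Bool} {p q : Prog} {s : Store} (hk : s.get k = []) :
    Within (.loop k e p q) s 1 s := ⟨1, le_rfl, .loopNil hk⟩

theorem loopTrue {k : Reg} {e : Bool} {p q : Prog} {s s' s'' : Store} {l : List Bool} {n m : ℕ}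
    (hk : s.get k = true :: l) (h : Within p (s.set k l) n s')
    (h' : Within (.loop k e p q) s' m s'') : Within (.loop k e p q) s (1 + n + m) s'' := by
  obtain ⟨t, ht, h⟩ := h
  obtain ⟨t', ht', h'⟩ := h'
  exact ⟨1 + t + t', by omega, .loopTrue hk h h'⟩

theorem loopFalse {k : Reg} {p q : Prog} {s s' s'' : Store} {l : List Bool} {n m : ℕ}
    (hk : s.get k = false :: l) (h : Within q (s.set k l) n s')
    (h' : Within (.loop k true p q) s' m s'') :
    Within (.loop k true p q) s (1 + n + m) s'' := by
  obtain ⟨t, ht, h⟩ := h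
  obtain ⟨t', ht', h'⟩ := h'
  exact ⟨1 + t + t', by omega, .loopFalse hk h h'⟩

theorem loopExit {k : Reg} {p q : Prog} {s s' : Store} {l : List Bool} {n : ℕ}
    (hk : s.get k = false :: l) (h : Within q (s.set k l) n s') :
    Within (.loop k false p q) s (1 + n) s' := by
  obtain ⟨t, ht, h⟩ := h
  exact ⟨1 + t, by omega, .loopExit hk h⟩

end Within

/-! ### Binary trees -/

/-- Binary trees, the values on which programs operate. -/
inductive T where
  | nil
  | cons (x y : T)
  deriving DecidableEq

namespace T

/-- The word that represents a tree on a stack. -/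
def word : T → List Bool
  | nil => [false]
  | cons x y => true :: (x.word ++ y.word)

/-- The length of the word that represents a tree. -/
def size : T → ℕ
  | nil => 1
  | cons x y => 1 + x.size + y.size

theorem length_word (x : T) : x.word.length = x.size := by
  induction x with
  | nil => rfl
  | cons x y hx hy => simp [word, size, hx, hy]; omega

theorem one_le_size (x : T) : 1 ≤ x.size := by
  cases x <;> simp [size, add_assoc]

/-- The left subtree. -/
def car : T → T
  | nil => nil
  | cons x _ => x

/-- The right subtree. -/
def cdr : T → T
  | nil => nil
  | cons _ y => y

end T

/-! ### Tree operations on the value stack -/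

namespace Prog

/-- Move the topmost tree of the value stack to the stack `k`, in reverse. -/
def moveTree (k : Reg) : Prog :=
  .seq (.push .d true) (.loop .d true
    (.cases .r (.seq (.push k true) (.seq (.push .d true) (.push .d true))) (.push k false)) .skip)

/-- Move all of `k` to `l`, in reverse. -/
def pour (k l : Reg) : Prog := .loop k true (.push l true) (.push l false)

/-- Move all of `k` to both `l` and `m`, in reverse. -/
def pourTwo (k l m : Reg) : Prog :=
  .loop k true (.seq (.push l true) (.push m true)) (.seq (.push l false) (.push m false))

/-- Empty the stack `k`. -/
def clear (k : Reg) : Prog := .loop k true .skip .skip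

/-- Remove the topmost tree. -/
def drop : Prog := .seq (moveTree .b) (clear .b)

/-- Duplicate the topmost tree. -/
def dup : Prog := .seq (moveTree .b) (.seq (pourTwo .b .r .c) (.seq (pour .c .b) (pour .b .r)))

/-- Exchange the two topmost trees. -/
def swap : Prog :=
  .seq (moveTree .b) (.seq (moveTree .c) (.seq (pour .b .r) (pour .c .r)))

end Prog

open Prog

/-- The stack `d` holds, in unary, the number of subtrees still to be moved: an inner node replaces
one pending tree by two, a leaf removes one. The rest of the loop appears as a continuation of cost
`n`, so that the two subtrees of a node can be chained. An inner node costs five steps: loop test,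
branch and three pushes. -/
theorem within_moveTree_loop {k : Reg} (hk : k = .b ∨ k = .c) (x : T) :
    ∀ (s s' : Store) (rest dd : List Bool) (n : ℕ), s.r = x.word ++ rest → s.d = true :: dd →
    Within (.loop .d true (.cases .r (.seq (.push k true) (.seq (.push .d true) (.push .d true)))
      (.push k false)) .skip)
      { s.set k (x.word.reverse ++ s.get k) with r := rest, d := dd } n s' →
    Within (.loop .d true (.cases .r (.seq (.push k true) (.seq (.push .d true) (.push .d true)))
      (.push k false)) .skip) s (5 * x.size + n) s' := by
  induction x with
  | nil =>
    rintro ⟨r, a, b, c, d⟩ s' rest dd n hr hd h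
    simp only at hr hd
    subst hr hd
    have h1 : Within (.push k false) ⟨rest, a, b, c, dd⟩ 1
      { (Store.mk rest a b c dd).set k (false :: (Store.mk rest a b c dd).get k) with
        r := rest, d := dd } := by
      rcases hk with rfl | rfl <;> exact Within.push _ _ _
    refine Within.mono (Within.loopTrue rfl (Within.casesFalse rfl h1) (m := n) ?_)
      (by simp only [T.size]; omega)
    rcases hk with rfl | rfl <;> exact h
  | cons x y hx hy =>
    rintro ⟨r, a, b, c, d⟩ s' rest dd n hr hd h
    simp only at hr hd
    subst hr hd
    have h1 : Within (.seq (.push k true) (.seq (.push .d true) (.push .d true)))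
      ⟨x.word ++ y.word ++ rest, a, b, c, dd⟩ (1 + (1 + 1))
      { (Store.mk rest a b c dd).set k (true :: (Store.mk rest a b c dd).get k) with
        r := x.word ++ y.word ++ rest, d := true :: true :: dd } := by
      rcases hk with rfl | rfl <;>
        exact Within.seq (Within.push _ _ _) (Within.seq (Within.push _ _ _) (Within.push _ _ _))
    refine Within.mono (Within.loopTrue rfl (Within.casesTrue rfl h1) (m := 5 * x.size +
      (5 * y.size + n)) ?_) (by simp only [T.size]; omega)
    refine hx _ _ (y.word ++ rest) (true :: dd) _ (by simp) rfl
      (hy _ _ rest dd _ rfl rfl ?_)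
    rcases hk with rfl | rfl <;>
      simpa [Store.set, Store.get, T.word] using h

theorem within_moveTree {k : Reg} (hk : k = .b ∨ k = .c) (x : T) (s : Store) (rest : List Bool)
    (hr : s.r = x.word ++ rest) (hd : s.d = []) :
    Within (moveTree k) s (5 * x.size + 2)
      { s.set k (x.word.reverse ++ s.get k) with r := rest } := by
  obtain ⟨r, a, b, c, d⟩ := s
  simp only at hr hd
  subst hr hd
  have h := within_moveTree_loop hk x ⟨x.word ++ rest, a, b, c, [true]⟩ _ rest [] 1 rfl rfl
    (Within.loopNil rfl)
  refine Within.mono (Within.seq (Within.push _ _ _) (m := 5 * x.size + 1) ?_) (by omega)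
  rcases hk with rfl | rfl <;> exact h

theorem within_pour_br (l r a c d : List Bool) :
    Within (pour .b .r) ⟨r, a, l, c, d⟩ (2 * l.length + 1) ⟨l.reverse ++ r, a, [], c, d⟩ := by
  induction l generalizing r with
  | nil => exact Within.loopNil rfl
  | cons x l ih =>
    have := ih (x :: r)
    simp only [List.reverse_cons, List.append_assoc, List.singleton_append, List.length_cons]
    cases x
    · exact Within.mono (Within.loopFalse rfl (Within.push _ _ _) this) (by omega)
    · exact Within.mono (Within.loopTrue rfl (Within.push _ _ _) this) (by omega)

theorem within_pour_cr (l r a b d : List Bool) :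
    Within (pour .c .r) ⟨r, a, b, l, d⟩ (2 * l.length + 1) ⟨l.reverse ++ r, a, b, [], d⟩ := by
  induction l generalizing r with
  | nil => exact Within.loopNil rfl
  | cons x l ih =>
    have := ih (x :: r)
    simp only [List.reverse_cons, List.append_assoc, List.singleton_append, List.length_cons]
    cases x
    · exact Within.mono (Within.loopFalse rfl (Within.push _ _ _) this) (by omega)
    · exact Within.mono (Within.loopTrue rfl (Within.push _ _ _) this) (by omega)

theorem within_pour_cb (l r a b d : List Bool) :
    Within (pour .c .b) ⟨r, a, b, l, d⟩ (2 * l.length + 1) ⟨r, a, l.reverse ++ b, [], d⟩ := by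
  induction l generalizing b with
  | nil => exact Within.loopNil rfl
  | cons x l ih =>
    have := ih (x :: b)
    simp only [List.reverse_cons, List.append_assoc, List.singleton_append, List.length_cons]
    cases x
    · exact Within.mono (Within.loopFalse rfl (Within.push _ _ _) this) (by omega)
    · exact Within.mono (Within.loopTrue rfl (Within.push _ _ _) this) (by omega)

theorem within_pourTwo (l r a c d : List Bool) :
    Within (pourTwo .b .r .c) ⟨r, a, l, c, d⟩ (3 * l.length + 1)
      ⟨l.reverse ++ r, a, [], l.reverse ++ c, d⟩ := by
  induction l generalizing r c with
  | nil => exact Within.loopNil rfl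
  | cons x l ih =>
    have := ih (x :: r) (x :: c)
    simp only [List.reverse_cons, List.append_assoc, List.singleton_append, List.length_cons]
    cases x
    · exact Within.mono (Within.loopFalse rfl (Within.seq (Within.push _ _ _) (Within.push _ _ _)) this)
        (by omega)
    · exact Within.mono (Within.loopTrue rfl (Within.seq (Within.push _ _ _) (Within.push _ _ _)) this)
        (by omega)

theorem within_clear_b (l r a c d : List Bool) :
    Within (clear .b) ⟨r, a, l, c, d⟩ (2 * l.length + 1) ⟨r, a, [], c, d⟩ := by
  induction l with
  | nil => exact Within.loopNil rfl
  | cons x l ih =>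
    simp only [List.length_cons]
    cases x
    · exact Within.mono (Within.loopFalse rfl (Within.skip _) ih) (by omega)
    · exact Within.mono (Within.loopTrue rfl (Within.skip _) ih) (by omega)

theorem within_clear_c (l r a b d : List Bool) :
    Within (clear .c) ⟨r, a, b, l, d⟩ (2 * l.length + 1) ⟨r, a, b, [], d⟩ := by
  induction l with
  | nil => exact Within.loopNil rfl
  | cons x l ih =>
    simp only [List.length_cons]
    cases x
    · exact Within.mono (Within.loopFalse rfl (Within.skip _) ih) (by omega)
    · exact Within.mono (Within.loopTrue rfl (Within.skip _) ih) (by omega)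

/-- The store with value stack `r`, counter stack `a`, and empty scratch stacks. -/
abbrev vals (r a : List Bool) : Store := ⟨r, a, [], [], []⟩

theorem within_drop (x : T) (rest a : List Bool) :
    Within drop (vals (x.word ++ rest) a) (20 * x.size) (vals rest a) := by
  have := x.one_le_size
  refine ((within_moveTree (.inl rfl) x _ rest rfl rfl).seq (within_clear_b _ _ _ _ _)).mono ?_
  simp only [Store.get, Store.set, List.append_nil, List.length_reverse, T.length_word]
  omega

theorem within_dup (x : T) (rest a : List Bool) :
    Within dup (vals (x.word ++ rest) a) (20 * x.size) (vals (x.word ++ (x.word ++ rest)) a) := by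
  have := x.one_le_size
  have h1 := within_moveTree (.inl rfl) x (vals (x.word ++ rest) a) rest rfl rfl
  simp only [Store.get, Store.set, List.append_nil] at h1
  have h2 := within_pourTwo x.word.reverse rest a [] []
  have h3 := within_pour_cb x.word (x.word ++ rest) a [] []
  have h4 := within_pour_br x.word.reverse (x.word ++ rest) a [] []
  simp only [List.append_nil, List.length_reverse, T.length_word, List.reverse_reverse] at h2 h3 h4
  exact (h1.seq (h2.seq (h3.seq h4))).mono (by omega)

theorem within_swap (x y : T) (rest a : List Bool) :
    Within swap (vals (x.word ++ (y.word ++ rest)) a) (20 * (x.size + y.size))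
      (vals (y.word ++ (x.word ++ rest)) a) := by
  have := x.one_le_size
  have := y.one_le_size
  have h1 := within_moveTree (.inl rfl) x (vals (x.word ++ (y.word ++ rest)) a) (y.word ++ rest)
    rfl rfl
  simp only [Store.get, Store.set, List.append_nil] at h1
  have h2 := within_moveTree (.inr rfl) y ⟨y.word ++ rest, a, x.word.reverse, [], []⟩ rest
    rfl rfl
  have h3 := within_pour_br x.word.reverse rest a y.word.reverse []
  have h4 := within_pour_cr y.word.reverse (x.word ++ rest) a [] []
  simp only [Store.get, Store.set, List.append_nil, List.length_reverse, T.length_word,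
    List.reverse_reverse] at h2 h3 h4
  exact (h1.seq (h2.seq (h3.seq h4))).mono (by omega)

/-! ### Polynomial-time functions between types of finite objects -/

/-- Types whose elements are represented by trees. -/
class Enc (α : Type) where
  /-- the tree that represents an element -/
  enc : α → T
  inj : Function.Injective enc

/-- The size of the tree that represents an element. -/
abbrev sz {α : Type} [Enc α] (x : α) : ℕ := (Enc.enc x).size

instance : Enc T := ⟨id, fun _ _ h => h⟩

instance : Enc Unit := ⟨fun _ => .nil, fun _ _ _ => rfl⟩

instance : Enc Bool where
  enc b := match b with
    | false => .nil
    | true => .cons .nil .nil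
  inj := by rintro (_ | _) (_ | _) h <;> simp_all

/-- The tree that represents a natural number. -/
def encNat : ℕ → T
  | 0 => .nil
  | n + 1 => .cons .nil (encNat n)

instance : Enc ℕ where
  enc := encNat
  inj := by
    intro n
    induction n with
    | zero => rintro (_ | m) h <;> simp_all [encNat]
    | succ n ih =>
      rintro (_ | m) h
      · simp [encNat] at h
      · simp only [encNat, T.cons.injEq, true_and] at h
        rw [ih h]

instance {α β : Type} [Enc α] [Enc β] : Enc (α × β) where
  enc x := .cons (Enc.enc x.1) (Enc.enc x.2)
  inj := by
    rintro ⟨a, b⟩ ⟨c, d⟩ h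
    simp only [T.cons.injEq] at h
    rw [Enc.inj h.1, Enc.inj h.2]

instance {α : Type} [Enc α] : Enc (Option α) where
  enc x := match x with
    | none => .nil
    | some a => .cons .nil (Enc.enc a)
  inj := by
    rintro (_ | a) (_ | b) h <;> simp_all [Enc.inj.eq_iff]

/-- The tree that represents a list. -/
def encList {α : Type} [Enc α] : List α → T
  | [] => .nil
  | a :: l => .cons (Enc.enc a) (encList l)

instance {α : Type} [Enc α] : Enc (List α) where
  enc := encList
  inj := by
    intro l
    induction l with
    | nil => rintro (_ | ⟨b, m⟩) h <;> simp_all [encList]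
    | cons a l ih =>
      rintro (_ | ⟨b, m⟩) h
      · simp [encList] at h
      · simp only [encList, T.cons.injEq] at h
        rw [Enc.inj h.1, ih h.2]

open Prog

theorem eval_mono (P : Polynomial ℕ) {n m : ℕ} (h : n ≤ m) : P.eval n ≤ P.eval m := by
  induction P using Polynomial.induction_on' with
  | add p q hp hq => simpa using add_le_add hp hq
  | monomial k a => simpa using Nat.mul_le_mul_left a (Nat.pow_le_pow_left h k)

/-- The program `p` turns the tree `e i` at the top of the value stack into `f i`, for all `i`, within
the time bound and with the size bound `P`. -/
def Implements {ι : Type} (p : Prog) (P : Polynomial ℕ) (e f : ι → T) : Prop :=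
  ∀ i, (f i).size ≤ P.eval (e i).size ∧ ∀ rest a,
    Within p (vals ((e i).word ++ rest) a) (P.eval (e i).size) (vals ((f i).word ++ rest) a)

/-- A program turns `e i` into `f i`, for all `i`, in polynomial time. -/
def PolyTree {ι : Type} (e f : ι → T) : Prop :=
  ∃ p P, Implements p P e f

namespace PolyTree

variable {ι : Type} {e : ι → T}

open Polynomial in
theorem refl (e : ι → T) : PolyTree e e := by
  refine ⟨.skip, X, fun i => ⟨by simp, fun rest a => (Within.skip _).mono ?_⟩⟩
  simpa using (e i).one_le_size

open Polynomial in
theorem trans {f g : ι → T} (hf : PolyTree e f) (hg : PolyTree f g) : PolyTree e g := by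
  obtain ⟨p, P, hp⟩ := hf
  obtain ⟨q, Q, hq⟩ := hg
  refine ⟨.seq p q, P + Q.comp P, fun i => ?_⟩
  have h := eval_mono Q (hp i).1
  refine ⟨?_, fun rest a => Within.mono (((hp i).2 rest a).seq ((hq i).2 rest a)) ?_⟩
  · have := (hq i).1
    simp only [eval_add, eval_comp]
    omega
  · simp only [eval_add, eval_comp]
    omega

open Polynomial in
theorem const_nil (e : ι → T) : PolyTree e (fun _ => .nil) := by
  refine ⟨.seq drop (.push .r false), C 20 * X + 1, fun i => ⟨?_, fun rest a => ?_⟩⟩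
  · simp [T.size]
  · refine Within.mono ((within_drop (e i) rest a).seq (Within.push _ _ _)) ?_
    simp

open Polynomial in
theorem cons {f g : ι → T} (hf : PolyTree e f) (hg : PolyTree e g) :
    PolyTree e (fun i => .cons (f i) (g i)) := by
  obtain ⟨p, P, hp⟩ := hf
  obtain ⟨q, Q, hq⟩ := hg
  refine ⟨.seq dup (.seq p (.seq swap (.seq q (.seq swap (.push .r true))))),
    -- Duplication costs `20 * |e|` and the two swaps `20 * (|f| + |e|)` and `20 * (|g| + |f|)`,
    -- where `|f|` and `|g|` are bounded by `P` and `Q`; the programs add `P` and `Q`, and the last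
    -- push adds 1.
    C 40 * X + C 41 * P + C 21 * Q + 1, fun i => ⟨?_, fun rest a => ?_⟩⟩
  · have h1 := (hp i).1
    have h2 := (hq i).1
    simp only [T.size, eval_add, eval_mul, eval_C, eval_X, eval_one]
    omega
  · have h1 := (hp i).1
    have h2 := (hq i).1
    have h : Within _ (vals ((e i).word ++ rest) a) _ (vals (true :: ((f i).word ++
      ((g i).word ++ rest))) a) := (within_dup (e i) rest a).seq
      (((hp i).2 ((e i).word ++ rest) a).seq ((within_swap (f i) (e i) rest a).seq
      (((hq i).2 ((f i).word ++ rest) a).seq ((within_swap (g i) (f i) rest a).seq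
        (Within.push .r true _)))))
    simp only [T.word, List.cons_append, List.append_assoc]
    refine h.mono ?_
    simp only [eval_add, eval_mul, eval_C, eval_X, eval_one]
    omega

open Polynomial in
theorem car_refl : PolyTree (fun x => x) T.car := by
  refine ⟨.cases .r (.seq (moveTree .b) (.seq (moveTree .c) (.seq (clear .c) (pour .b .r))))
    (.push .r false), C 20 * X, fun x => ⟨?_, fun rest a => ?_⟩⟩
  · cases x <;> simp [T.size, T.car]; omega
  · cases x with
    | nil =>
      refine Within.mono (Within.casesFalse rfl (Within.push _ _ _)) ?_
      simp [T.size]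
    | cons x y =>
      have hx := x.one_le_size
      have h1 := within_moveTree (.inl rfl) x (vals (x.word ++ (y.word ++ rest)) a)
        (y.word ++ rest) rfl rfl
      have h2 := within_moveTree (.inr rfl) y ⟨y.word ++ rest, a, x.word.reverse, [], []⟩ rest
        rfl rfl
      have h3 := within_clear_c y.word.reverse rest a x.word.reverse []
      have h4 := within_pour_br x.word.reverse rest a [] []
      simp only [Store.get, Store.set, List.append_nil, List.length_reverse, T.length_word,
        List.reverse_reverse] at h1 h2 h3 h4
      simp only [T.word, List.cons_append, List.append_assoc, T.car]
      refine Within.mono (Within.casesTrue rfl (h1.seq (h2.seq (h3.seq h4)))) ?_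
      simp only [T.size, eval_mul, eval_C, eval_X]
      omega

open Polynomial in
theorem cdr_refl : PolyTree (fun x => x) T.cdr := by
  refine ⟨.cases .r drop (.push .r false), C 20 * X, fun x => ⟨?_, fun rest a => ?_⟩⟩
  · cases x <;> simp [T.size, T.cdr]; omega
  · cases x with
    | nil =>
      refine Within.mono (Within.casesFalse rfl (Within.push _ _ _)) ?_
      simp [T.size]
    | cons x y =>
      simp only [T.word, List.cons_append, List.append_assoc, T.cdr]
      refine Within.mono (Within.casesTrue rfl (within_drop x _ a)) ?_
      simp only [T.size, eval_mul, eval_C, eval_X]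
      omega

/-- Precomposition on both sides. -/
theorem reindex {κ : Type} {f : ι → T} (h : PolyTree e f) (φ : κ → ι) :
    PolyTree (fun k => e (φ k)) (fun k => f (φ k)) := by
  obtain ⟨p, P, hp⟩ := h
  exact ⟨p, P, fun k => hp (φ k)⟩

theorem car {f : ι → T} (hf : PolyTree e f) : PolyTree e (fun i => (f i).car) :=
  hf.trans (car_refl.reindex f)

theorem cdr {f : ι → T} (hf : PolyTree e f) : PolyTree e (fun i => (f i).cdr) :=
  hf.trans (cdr_refl.reindex f)

open Polynomial in
/-- Branching, where each branch is only computed where it is taken. -/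
theorem branch {c f : ι → T} (hc : PolyTree e c)
    (hf : PolyTree (fun i : {i // c i ≠ .nil} => e i) (fun i => f i))
    (hg : PolyTree (fun i : {i // c i = .nil} => e i) (fun i => f i)) : PolyTree e f := by
  obtain ⟨r, R, hr⟩ := hc
  obtain ⟨p, P, hp⟩ := hf
  obtain ⟨q, Q, hq⟩ := hg
  -- The first bit of the test value tells whether it is `nil`. If it is not, its two subtrees are
  -- still on the stack and are dropped before the branch runs.
  refine ⟨.seq dup (.seq r (.cases .r (.seq drop (.seq drop p)) q)),
    C 20 * X + C 21 * R + P + Q + 1, fun i => ?_⟩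
  simp only [eval_add, eval_mul, eval_C, eval_X, eval_one]
  have h1 := (hr i).1
  have h := fun rest a => ((hr i).2 ((e i).word ++ rest) a)
  cases hi : c i with
  | nil =>
    rw [hi] at h h1
    have h2 := hq ⟨i, hi⟩
    refine ⟨by have := h2.1; simp only at this; omega, fun rest a => ?_⟩
    refine Within.mono ((within_dup (e i) rest a).seq ((h rest a).seq
      (Within.casesFalse rfl (h2.2 rest a)))) ?_
    simp only
    omega
  | cons y z =>
    rw [hi] at h h1
    have h2 := hp ⟨i, by simp [hi]⟩
    refine ⟨by have := h2.1; simp only at this; omega, fun rest a => ?_⟩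
    have h3 := h rest a
    simp only [T.word, List.cons_append, List.append_assoc] at h3
    refine Within.mono ((within_dup (e i) rest a).seq (h3.seq
      (Within.casesTrue rfl ((within_drop y _ a).seq ((within_drop z _ a).seq
        (h2.2 rest a)))))) ?_
    simp only [T.size] at h1 ⊢
    omega

theorem congr {f g : ι → T} (hf : PolyTree e f) (h : ∀ i, f i = g i) : PolyTree e g := by
  rwa [← funext h]

theorem within_iterate {κ : Type} {b : κ → T} {p : Prog} {P : Polynomial ℕ} {h : κ → κ}
    (hp : Implements p P b (fun k => b (h k)))
    (rest a : List Bool) (N : ℕ) (n : ℕ) (k : κ) (hk : ∀ i < n, (b (h^[i] k)).size ≤ N) :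
    Within (.loop .a false p .skip) (vals ((b k).word ++ rest)
      (List.replicate n true ++ false :: a))
      (n * (1 + P.eval N) + 2) (vals ((b (h^[n] k)).word ++ rest) a) := by
  induction n generalizing k with
  | zero => exact Within.mono (Within.loopExit rfl (Within.skip _)) (by omega)
  | succ n ih =>
    have h1 := ih (h k) fun i hi => by
      simpa using hk (i + 1) (by omega)
    have h2 := (hp k).2 rest (List.replicate n true ++ false :: a)
    refine Within.mono (Within.loopTrue rfl h2 h1) ?_
    have := eval_mono P (hk 0 (by omega))
    simp only [Function.iterate_zero, id_eq] at this
    nlinarith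

theorem within_count (l r a c d : List Bool) (n : ℕ) :
    Within (.loop .b true (.push .a true) (.push .a true))
      ⟨r, List.replicate n true ++ a, l, c, d⟩
      (2 * l.length + 1) ⟨r, List.replicate (l.length + n) true ++ a, [], c, d⟩ := by
  induction l generalizing n with
  | nil => simpa using Within.loopNil rfl
  | cons x l ih =>
    have h := ih (n + 1)
    simp only [List.length_cons]
    rw [show l.length + 1 + n = l.length + (n + 1) by omega]
    cases x
    · exact Within.mono (Within.loopFalse rfl (Within.push _ _ _) h) (by omega)
    · exact Within.mono (Within.loopTrue rfl (Within.push _ _ _) h) (by omega)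

open Polynomial in
-- The number of rounds is the length of the word of `c i`, copied in unary to the stack `a`. A
-- `false` below the counter marks its end, so nested loops can share the stack. The bound `Q` is
-- essential: composing a polynomial-time map with itself may otherwise produce values of
-- exponential size.
theorem iterate {κ : Type} {b : κ → T} {c : ι → T} {g : ι → κ} {h : κ → κ} (hc : PolyTree e c)
    (hg : PolyTree e (fun i => b (g i))) (hh : PolyTree b (fun k => b (h k)))
    (Q : Polynomial ℕ)
    (hQ : ∀ i, ∀ j ≤ (c i).size, (b (h^[j] (g i))).size ≤ Q.eval (e i).size) :
    PolyTree e (fun i => b (h^[(c i).size] (g i))) := by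
  obtain ⟨q, S, hq⟩ := hc.cons hg
  obtain ⟨p, P, hp⟩ := hh
  refine ⟨.seq q (.cases .r (.seq (.push .a false) (.seq (moveTree .b)
    (.seq (.loop .b true (.push .a true) (.push .a true)) (.loop .a false p .skip)))) .skip),
    Q + C 10 * S + S * (1 + P.comp Q) + 7, fun i => ⟨?_, fun rest a => ?_⟩⟩
  · have := hQ i _ le_rfl
    simp only [eval_add]
    omega
  · have h1 := (hq i).2 rest a
    have h0 := (hq i).1
    simp only [T.word, List.cons_append, List.append_assoc, T.size] at h1 h0
    have h2 := within_moveTree (.inl rfl) (c i) (vals ((c i).word ++ ((b (g i)).word ++ rest))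
      (false :: a)) ((b (g i)).word ++ rest) rfl rfl
    have h3 := within_count (c i).word.reverse ((b (g i)).word ++ rest) (false :: a) [] [] 0
    have h4 := within_iterate hp rest a (Q.eval (e i).size) (c i).size (g i)
      fun j hj => hQ i j hj.le
    simp only [Store.get, Store.set, List.append_nil, List.length_reverse, T.length_word,
      List.replicate_zero, List.nil_append, add_zero] at h2 h3 h4
    refine Within.mono (h1.seq (Within.casesTrue rfl ((Within.push .a false _).seq
      (h2.seq (h3.seq h4))))) ?_
    simp only [eval_add, eval_mul, eval_C, eval_one, eval_comp, eval_ofNat]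
    have : (c i).size * (1 + P.eval (Q.eval (e i).size)) ≤
      S.eval (e i).size * (1 + P.eval (Q.eval (e i).size)) := Nat.mul_le_mul_right _ (by omega)
    omega

end PolyTree

/-- Functions that are computed in polynomial time. -/
@[fun_prop]
def Poly {α β : Type} [Enc α] [Enc β] (f : α → β) : Prop :=
  PolyTree Enc.enc (fun x => Enc.enc (f x))

/-! ### From polynomial-time functions to Turing machines -/

open Turing.TM2.Stmt

section Machine

variable {Λ : Type}

/-- Push a bit on a working stack. -/
def pushBit (k : Reg) (x : Bool) (q : Stm Λ) : Stm Λ := push (some k) (fun _ => x) q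

theorem stepAux_pushBit (k : Reg) (x : Bool) (q : Stm Λ) (v : Last) (i : List (Option Bool))
    (s : Store) :
    Turing.TM2.stepAux (pushBit k x q) v (tapes i s) =
      Turing.TM2.stepAux q v (tapes i (s.set k (x :: s.get k))) := by
  rw [← tapes_push]
  rfl

/-- Pop a symbol from the input and store it. -/
def popInput (q : Stm Λ) : Stm Λ := pop none (fun _ x => x) q

theorem stepAux_popInput (q : Stm Λ) (v : Last) (i : List (Option Bool)) (s : Store) :
    Turing.TM2.stepAux (popInput q) v (tapes i s) =
      Turing.TM2.stepAux q i.head? (tapes i.tail s) := by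
  conv_rhs => rw [← tapes_input i]
  rfl

/-- Push all bits of a list on the value stack. -/
def pushAll (l : List Bool) (q : Stm Λ) : Stm Λ := l.foldr (pushBit .r) q

theorem stepAux_pushAll (l : List Bool) (q : Stm Λ) (v : Last) (i : List (Option Bool))
    (s : Store) :
    Turing.TM2.stepAux (pushAll l q) v (tapes i s) =
      Turing.TM2.stepAux q v (tapes i { s with r := l.reverse ++ s.r }) := by
  induction l generalizing s with
  | nil => rfl
  | cons x l ih =>
    rw [pushAll, List.foldr_cons, stepAux_pushBit, ← pushAll, ih]
    simp [Store.set, Store.get]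

/-- The bits that are pushed for an input symbol. -/
def symbolBits (x : Option Bool) : List Bool := (true :: (Enc.enc x).word).reverse

/-- Load an input symbol and continue at `l`, or continue at `l'` at the end of the input. -/
def loadStm (l l' : Λ) : Stm Λ :=
  popInput (branch (fun v => v.isNone) (goto fun _ => l')
    (branch (fun v => v == some none)
      (pushAll (symbolBits none) (goto fun _ => l))
    (branch (fun v => v == some (some true))
      (pushAll (symbolBits (some true)) (goto fun _ => l))
      (pushAll (symbolBits (some false)) (goto fun _ => l)))))

/-- Convert a boolean to a bit. -/
def outputStm : Stm Λ :=
  popBit .r (branch (fun v => v == some (some true))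
    (popBit .r (popBit .r (pushBit .r true (load (fun _ => none) halt))))
    (pushBit .r false (load (fun _ => none) halt)))

/-- The labels of the machine that runs a program: the positions of the program, and labels for
initialisation, loading of the input, and conversion of the output. -/
abbrev MachineLab (p : Prog) : Type := p.Lab ⊕ Fin 3

/-- The machine that loads the input, runs a program, and converts the output. -/
def machine (p : Prog) : MachineLab p → Stm (MachineLab p)
  | .inl l => p.code .inl (.inr 2) l
  | .inr 0 => pushBit .r false (goto fun _ => .inr 1)
  | .inr 1 => loadStm (.inr 1) (.inl p.entry)
  | .inr 2 => outputStm

/-- Each symbol is put in front of those read before it, so the program receives the input word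
reversed; this is why `InP.of_poly_reverse` speaks of `f w.reverse`. -/
theorem machine_load (p : Prog) (w : List (Option Bool)) (u : List (Option Bool)) (v : Last) :
    Run (machine p) ⟨some (.inr 1), v, tapes w (vals (Enc.enc u).word [])⟩ (w.length + 1)
      ⟨some (.inl p.entry), none, tapes [] (vals (Enc.enc (w.reverse ++ u)).word [])⟩ := by
  induction w generalizing u v with
  | nil =>
    have h := Run.step (m := machine p) (l := .inr 1) (q := loadStm _ _) rfl v
      (tapes [] (vals (Enc.enc u).word []))
    rw [loadStm, stepAux_popInput] at h
    exact h
  | cons x w ih =>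
    have h := Run.step (m := machine p) (l := .inr 1) (q := loadStm _ _) rfl v
      (tapes (x :: w) (vals (Enc.enc u).word []))
    rw [loadStm, stepAux_popInput] at h
    have h' := ih (x :: u) (some x)
    have e3 : (Enc.enc (x :: u)).word = (symbolBits x).reverse ++ (Enc.enc u).word := by
      simp [symbolBits, Enc.enc, encList, T.word]
    rw [e3] at h'
    rw [List.length_cons, show w.length + 1 + 1 = 1 + (w.length + 1) by omega, List.reverse_cons,
      List.append_assoc, List.singleton_append]
    refine Run.trans ?_ h'
    rcases x with _ | _ | _ <;>
    · simp only [Turing.TM2.stepAux, stepAux_pushAll] at h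
      exact h

theorem machine_output (p : Prog) (b : Bool) (v : Last) :
    Run (machine p) ⟨some (.inr 2), v, tapes [] (vals (Enc.enc b).word [])⟩ 1
      ⟨none, none, tapes [] (vals [b] [])⟩ := by
  have h := Run.step (m := machine p) (l := .inr 2) (q := outputStm) rfl v
    (tapes [] (vals (Enc.enc b).word []))
  rw [outputStm, stepAux_popBit] at h
  cases b <;>
  · simp only [Turing.TM2.stepAux, stepAux_popBit, stepAux_pushBit] at h
    exact h

/-- The machine that runs a program as a bundled Turing machine. -/
def finTM2 (p : Prog) : Turing.FinTM2 where
  K := Option Reg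
  k₀ := none
  k₁ := some .r
  Γ := Stk
  Λ := MachineLab p
  main := .inr 0
  σ := Last
  initialState := none
  Γk₀Fin := inferInstanceAs (Fintype (Option Bool))
  m := machine p

theorem initList_finTM2 (p : Prog) (w : List (Option Bool)) :
    Turing.initList (finTM2 p) w = (⟨some (.inr 0), none, tapes w (vals [] [])⟩ :
      Turing.TM2.Cfg Stk (MachineLab p) Last) := by
  unfold Turing.initList
  congr 1
  funext k
  rcases k with _ | _ | _ <;> rfl

theorem haltList_finTM2 (p : Prog) (b : Bool) :
    Turing.haltList (finTM2 p) [b] = (⟨none, none, tapes [] (vals [b] [])⟩ :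
      Turing.TM2.Cfg Stk (MachineLab p) Last) := by
  unfold Turing.haltList
  congr 1
  funext k
  rcases k with _ | _ | _ <;> rfl

end Machine

theorem InP.of_poly_reverse {L : Language (Option Bool)} {f : List (Option Bool) → Bool}
    (hf : Poly f) (h : ∀ w, f w.reverse = true ↔ w ∈ L) : InP L := by
  obtain ⟨p, P, hp⟩ := hf
  have size_le (w : List (Option Bool)) : (Enc.enc w).size ≤ 6 * w.length + 1 := by
    induction w with
    | nil => simp [Enc.enc, encList, T.size]
    | cons x w ih =>
      have : (Enc.enc (x :: w)).size = 1 + (Enc.enc x).size + (Enc.enc w).size := rfl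
      rw [this, List.length_cons]
      have : (Enc.enc x).size ≤ 5 := by rcases x with _ | _ | _ <;> simp [Enc.enc, T.size]
      omega
  refine ⟨⟨⟨finTM2 p, Equiv.refl (Option Bool), Equiv.refl Bool⟩,
    -- A word of length m is a tree of size at most 6m + 1. The other m + 3 steps are one for
    -- initialisation, m + 1 for loading and one for the output.
    P.comp (.C 6 * .X + 1) + .X + 3, fun w => ?_⟩⟩
  have h1 : Run (machine p) ⟨some (.inr 0), none, tapes w (vals [] [])⟩ 1
      ⟨some (.inr 1), none, tapes w (vals (Enc.enc ([] : List (Option Bool))).word [])⟩ := by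
    have := Run.step (m := machine p) (l := .inr 0) (q := pushBit _ _ _) rfl none
      (tapes w (vals [] []))
    rw [stepAux_pushBit] at this
    exact this
  have h2 := machine_load p w [] none
  rw [List.append_nil] at h2
  have h3 : ∃ t ≤ P.eval (Enc.enc w.reverse).size, ∃ v, Run (machine p)
      ⟨some (.inl p.entry), none, tapes [] (vals (Enc.enc w.reverse).word [])⟩ t
      ⟨some (.inr 2), v, tapes [] (vals (Enc.enc (f w.reverse)).word [])⟩ := by
    obtain ⟨t, ht, he⟩ := (hp w.reverse).2 [] []
    simp only [List.append_nil] at he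
    obtain ⟨v, hv⟩ := he.run (m := machine p) [] .inl (.inr 2) (fun l => rfl) none
    exact ⟨t, ht, v, hv⟩
  choose t ht v h3 using h3
  have h4 := machine_output p (f w.reverse) v
  have h5 := h1.trans (h2.trans (h3.trans h4))
  refine ⟨⟨1 + (w.length + 1 + (t + 1)), ?_⟩, ?_⟩
  · have hb (_ : Decidable (w ∈ L)) : decide (w ∈ L) = f w.reverse := by
      by_cases hw : w ∈ L
      · simp [hw, (h w).2 hw]
      · have : f w.reverse ≠ true := fun h' => hw ((h w).1 h')
        simp [hw, this]
    have h6 := initList_finTM2 p w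
    have h7 := haltList_finTM2 p (f w.reverse)
    rw [← h6, ← h7] at h5
    rw [hb]
    have e1 : List.map (Equiv.refl (Option Bool)).invFun (id w) = w := List.map_id _
    exact e1.symm ▸ h5
  · have h6 := eval_mono P (size_le w.reverse)
    simp only [id_eq, Polynomial.eval_add, Polynomial.eval_comp, Polynomial.eval_mul,
      Polynomial.eval_C, Polynomial.eval_X, Polynomial.eval_one, Polynomial.eval_ofNat]
    rw [List.length_reverse] at h6
    omega

/-! ### Closure properties of polynomial-time functions -/

namespace Poly

variable {α β γ δ : Type} [Enc α] [Enc β] [Enc γ] [Enc δ]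

theorem bound {f : α → β} (hf : Poly f) : ∃ P : Polynomial ℕ, ∀ x, sz (f x) ≤ P.eval (sz x) := by
  obtain ⟨p, P, hp⟩ := hf
  exact ⟨P, fun x => (hp x).1⟩

theorem of_tree {f : α → β} {g : α → T} (h : PolyTree Enc.enc g) (hg : ∀ x, g x = Enc.enc (f x)) :
    Poly f := h.congr hg

theorem of_enc {f : α → β} {g : α → γ} (hf : Poly f) (h : ∀ x, Enc.enc (f x) = Enc.enc (g x)) :
    Poly g := PolyTree.congr hf h

@[fun_prop]
theorem id' : Poly (fun x : α => x) := PolyTree.refl _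

@[fun_prop]
theorem comp {f : β → γ} {g : α → β} (hf : Poly f) (hg : Poly g) : Poly (fun x => f (g x)) :=
  hg.trans (hf.reindex g)

@[fun_prop]
theorem const (c : β) : Poly (fun _ : α => c) := by
  have (t : T) : PolyTree (Enc.enc : α → T) (fun _ => t) := by
    induction t with
    | nil => exact PolyTree.const_nil _
    | cons x y hx hy => exact hx.cons hy
  exact this _

@[fun_prop]
theorem mk {f : α → β} {g : α → γ} (hf : Poly f) (hg : Poly g) : Poly (fun x => (f x, g x)) :=
  PolyTree.cons hf hg

@[fun_prop]
theorem fst : Poly (fun x : α × β => x.1) :=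
  (PolyTree.refl (Enc.enc : α × β → T)).car

@[fun_prop]
theorem snd : Poly (fun x : α × β => x.2) :=
  (PolyTree.refl (Enc.enc : α × β → T)).cdr

@[fun_prop]
theorem cond' {c : α → Bool} {f g : α → β} (hc : Poly c) (hf : Poly f) (hg : Poly g) :
    Poly (fun x => cond (c x) (f x) (g x)) := by
  refine PolyTree.branch hc ((hf.reindex Subtype.val).congr fun x => ?_)
    ((hg.reindex Subtype.val).congr fun x => ?_)
  · have := x.2
    cases h : c x.1
    · exact absurd (by rw [h]; rfl) this
    · simp only [h, cond_true]
  · have := x.2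
    cases h : c x.1
    · simp only [h, cond_false]
    · rw [h] at this
      exact absurd this (by simp [Enc.enc])

@[fun_prop]
theorem and' {f g : α → Bool} (hf : Poly f) (hg : Poly g) : Poly (fun x => f x && g x) := by
  have : Poly (fun x => cond (f x) (g x) false) := by fun_prop
  exact this.of_enc fun x => by cases f x <;> rfl

@[fun_prop]
theorem or' {f g : α → Bool} (hf : Poly f) (hg : Poly g) : Poly (fun x => f x || g x) := by
  have : Poly (fun x => cond (f x) true (g x)) := by fun_prop
  exact this.of_enc fun x => by cases f x <;> rfl

@[fun_prop]
theorem not' {f : α → Bool} (hf : Poly f) : Poly (fun x => !(f x)) := by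
  have : Poly (fun x => cond (f x) false true) := by fun_prop
  exact this.of_enc fun x => by cases f x <;> rfl

@[fun_prop]
theorem listCons {f : α → β} {l : α → List β} (hf : Poly f) (hl : Poly l) :
    Poly (fun x => f x :: l x) :=
  PolyTree.cons hf hl

@[fun_prop]
theorem listTail {l : α → List β} (hl : Poly l) : Poly (fun x => (l x).tail) := by
  exact of_tree (PolyTree.cdr hl) fun x => by cases l x <;> rfl

/-- Case distinction on a list. -/
def _root_.GenReach.listCases {β γ : Type} (l : List β) (c : γ) (f : β → List β → γ) : γ :=
  match l with
  | [] => c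
  | b :: t => f b t

@[fun_prop]
theorem listCases {l : α → List β} {c : α → γ} {f : α → β → List β → γ} (hl : Poly l)
    (hc : Poly c) (hf : Poly (fun x : α × β × List β => f x.1 x.2.1 x.2.2)) :
    Poly (fun x => GenReach.listCases (l x) (c x) (f x)) := by
  have hne (x : {x : α // Enc.enc (l x) ≠ .nil}) : l x.1 ≠ [] := fun h => x.2 (by rw [h]; rfl)
  refine PolyTree.branch hl ?_ ((hc.reindex Subtype.val).congr fun x => ?_)
  · let φ (x : {x : α // Enc.enc (l x) ≠ .nil}) : α × β × List β :=
      (x.1, (l x.1).head (hne x), (l x.1).tail)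
    have h1 := hf.reindex φ
    have h2 : PolyTree (fun x : {x : α // Enc.enc (l x) ≠ .nil} => Enc.enc x.1)
        (fun x => Enc.enc (φ x)) := by
      have h3 := hl.reindex (Subtype.val (p := fun x => Enc.enc (l x) ≠ .nil))
      refine ((PolyTree.refl _).cons (h3.car.cons h3.cdr)).congr fun x => ?_
      have h4 : l x.1 = (l x.1).head (hne x) :: (l x.1).tail := by simp
      simp only [φ]
      -- The head depends on a proof about `l x.1`, so it is generalised before `l x.1` is
      -- rewritten.
      generalize (l x.1).head (hne x) = b at h4
      rw [h4]
      rfl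
    refine (h2.trans h1).congr fun x => ?_
    have h4 : l x.1 = (l x.1).head (hne x) :: (l x.1).tail := by simp
    simp only [φ]
    generalize (l x.1).head (hne x) = b at h4
    rw [h4]
    rfl
  · have := x.2
    cases h : l x.1
    · simp only [h]
      rfl
    · rw [h] at this
      exact absurd this (by simp [Enc.enc, encList])

/-- Case distinction on an option. -/
def _root_.GenReach.optionCases {β γ : Type} (l : Option β) (c : γ) (f : β → γ) : γ :=
  match l with
  | none => c
  | some b => f b

@[fun_prop]
theorem optionCases {l : α → Option β} {c : α → γ} {f : α → β → γ} (hl : Poly l)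
    (hc : Poly c) (hf : Poly (fun x : α × β => f x.1 x.2)) :
    Poly (fun x => GenReach.optionCases (l x) (c x) (f x)) := by
  let m (x : α) : List β := (l x).toList
  have hm : Poly m := by
    have h1 : PolyTree Enc.enc fun x => Enc.enc (l x) := hl
    refine PolyTree.branch h1 ((h1.cdr.cons (PolyTree.const_nil _)).reindex Subtype.val |>.congr
      fun x => ?_) ((PolyTree.const_nil _).reindex Subtype.val |>.congr fun x => ?_)
    · cases h : l x.1 with
      | none => exact absurd (by rw [h]; rfl) x.2
      | some b => simp only [m, h]; rfl
    · cases h : l x.1 with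
      | none => simp only [m, h]; rfl
      | some b =>
        have := x.2
        rw [h] at this
        exact absurd this (by simp [Enc.enc])
  have : Poly (fun x => GenReach.listCases (m x) (c x) (fun b _ => f x b)) := by fun_prop
  exact this.of_enc fun x => by
    simp only [m]
    cases l x <;> rfl

theorem iterate {c : α → γ} {g : α → β} {h : β → β} (hc : Poly c) (hg : Poly g) (hh : Poly h)
    (Q : Polynomial ℕ) (hQ : ∀ x, ∀ j ≤ sz (c x), sz (h^[j] (g x)) ≤ Q.eval (sz x)) :
    Poly (fun x => h^[sz (c x)] (g x)) :=
  PolyTree.iterate hc hg hh Q hQ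

theorem one_le_sz (x : α) : 1 ≤ sz x := T.one_le_size _

theorem sz_mk (x : α) (y : β) : sz (x, y) = 1 + sz x + sz y := rfl

theorem sz_nil : sz ([] : List α) = 1 := rfl

theorem sz_cons (x : α) (l : List α) : sz (x :: l) = 1 + sz x + sz l := rfl

theorem sz_append (l m : List α) : sz (l ++ m) + 1 = sz l + sz m := by
  induction l with
  | nil => rw [List.nil_append, sz_nil]; omega
  | cons a l ih => rw [List.cons_append, sz_cons, sz_cons]; omega

theorem sz_drop_le (l : List α) (n : ℕ) : sz (l.drop n) ≤ sz l := by
  have h := sz_append (l.take n) (l.drop n)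
  rw [List.take_append_drop] at h
  have := one_le_sz (l.take n)
  omega

theorem length_lt_sz (l : List α) : l.length < sz l := by
  induction l with
  | nil => simp [sz_nil]
  | cons a l ih => rw [sz_cons, List.length_cons]; omega

theorem sz_le_of_mem {l : List α} {a : α} (h : a ∈ l) : sz a ≤ sz l := by
  induction l with
  | nil => simp at h
  | cons b l ih =>
    rw [sz_cons]
    rcases List.mem_cons.1 h with rfl | h
    · omega
    · have := ih h; omega

theorem sz_le_length_mul {l : List α} {N : ℕ} (h : ∀ a ∈ l, sz a ≤ N) :
    sz l ≤ l.length * (N + 1) + 1 := by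
  induction l with
  | nil => simp [sz_nil]
  | cons a l ih =>
    rw [sz_cons, List.length_cons]
    have h1 := h a (by simp)
    have h2 := ih fun b hb => h b (by simp [hb])
    nlinarith

open Polynomial in
-- The state consists of the parameter, the accumulator and the unread part of the list. It is
-- iterated `sz (l x)` times, which exceeds the length of the list; the surplus rounds change
-- nothing, because `step` fixes states with an empty list. The accumulator must be polynomially
-- bounded after every prefix.
theorem foldl {l : α → List β} {c : α → γ} {f : α → γ → β → γ} (hl : Poly l) (hc : Poly c)
    (hf : Poly (fun x : α × γ × β => f x.1 x.2.1 x.2.2)) (Q : Polynomial ℕ)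
    (hQ : ∀ x l₁ l₂, l x = l₁ ++ l₂ → sz (l₁.foldl (f x) (c x)) ≤ Q.eval (sz x)) :
    Poly (fun x => (l x).foldl (f x) (c x)) := by
  let step (s : α × γ × List β) : α × γ × List β :=
    GenReach.listCases s.2.2 s fun b t => (s.1, f s.1 s.2.1 b, t)
  have hs : Poly step := by
    have : Poly (fun s : (α × γ × List β) × β × List β => f s.1.1 s.1.2.1 s.2.1) :=
      hf.comp (f := fun x : α × γ × β => f x.1 x.2.1 x.2.2)
        (g := fun s : (α × γ × List β) × β × List β => (s.1.1, s.1.2.1, s.2.1)) (by fun_prop)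
    fun_prop
  have key (x : α) (j : ℕ) : ∀ (m : List β) (y : γ),
      step^[j] (x, y, m) = (x, (m.take j).foldl (f x) y, m.drop j) := by
    induction j with
    | zero => simp
    | succ j ih =>
      rintro (_ | ⟨b, m⟩) y
      · have : step (x, y, []) = (x, y, []) := rfl
        rw [Function.iterate_fixed this]
        simp
      · rw [Function.iterate_succ_apply]
        exact ih m (f x y b)
  obtain ⟨P, hP⟩ := hl.bound
  have := iterate (c := l) (g := fun x => (x, c x, l x)) hl (by fun_prop) hs
    (X + P + Q + 2) fun x j _ => by
      rw [key, sz_mk, sz_mk]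
      have h1 := hQ x _ _ (List.take_append_drop j (l x)).symm
      have h2 := (sz_drop_le (l x) j).trans (hP x)
      simp only [eval_add, eval_X, eval_ofNat]
      omega
  have h2 : Poly (fun x => (step^[sz (l x)] (x, c x, l x)).2.1) := by fun_prop
  refine h2.of_enc fun x => ?_
  rw [key, List.take_of_length_le (length_lt_sz _).le]

@[fun_prop]
theorem reverse {l : α → List β} (hl : Poly l) : Poly (fun x => (l x).reverse) := by
  obtain ⟨P, hP⟩ := hl.bound
  have key (l₁ : List β) : l₁.foldl (fun c b => b :: c) [] = l₁.reverse := by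
    simp
  have h2 (l₁ : List β) : sz l₁.reverse = sz l₁ := by
    induction l₁ with
    | nil => rfl
    | cons a m ih =>
      have := sz_append m.reverse [a]
      rw [sz_cons, sz_nil] at this
      rw [List.reverse_cons, sz_cons]
      omega
  have := foldl (l := l) (c := fun _ => ([] : List β)) (f := fun _ c b => b :: c) hl
    (by fun_prop) (by fun_prop) P fun x l₁ l₂ h => by
      rw [key, h2]
      refine le_trans ?_ (hP x)
      have := sz_append l₁ l₂
      have := one_le_sz l₂
      rw [h]
      omega
  exact this.of_enc fun x => by rw [key]

@[fun_prop]
theorem append {l m : α → List β} (hl : Poly l) (hm : Poly m) : Poly (fun x => l x ++ m x) := by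
  obtain ⟨P, hP⟩ := hl.reverse.bound
  obtain ⟨Q, hQ⟩ := hm.bound
  have key (l₁ m : List β) : l₁.foldl (fun c b => b :: c) m = l₁.reverse ++ m := by
    simp
  have h2 (l₁ m : List β) : sz (l₁.foldl (fun c b => b :: c) m) + 1 = sz l₁ + sz m := by
    induction l₁ generalizing m with
    | nil => rw [List.foldl_nil, sz_nil]; omega
    | cons a l₁ ih => rw [List.foldl_cons, sz_cons, ih, sz_cons]; omega
  have := foldl (l := fun x => (l x).reverse) (c := m) (f := fun _ c b => b :: c) (by fun_prop)
    hm (by fun_prop) (P + Q) fun x l₁ l₂ h => by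
      have h1 := h2 l₁ (m x)
      have h3 := sz_append l₁ l₂
      have h4 := one_le_sz l₂
      have h5 := hP x
      have h6 := hQ x
      rw [h] at h5
      simp only [Polynomial.eval_add]
      omega
  exact this.of_enc fun x => by rw [key, List.reverse_reverse]

open Polynomial in
@[fun_prop]
theorem flatMap {l : α → List β} {f : α → β → List γ} (hl : Poly l)
    (hf : Poly (fun x : α × β => f x.1 x.2)) : Poly (fun x => (l x).flatMap (f x)) := by
  obtain ⟨P, hP⟩ := hl.bound
  obtain ⟨Q, hQ⟩ := hf.bound
  have key (f : β → List γ) (l₁ : List β) (m : List γ) :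
      l₁.foldl (fun c b => c ++ f b) m = m ++ l₁.flatMap f := by
    induction l₁ generalizing m with
    | nil => simp
    | cons a l₁ ih => simp [ih]
  have hs (f : β → List γ) (l₁ : List β) (N : ℕ) (hN : ∀ b ∈ l₁, sz (f b) ≤ N) :
      sz (l₁.flatMap f) ≤ l₁.length * N + 1 := by
    induction l₁ with
    | nil => simp [sz_nil]
    | cons a l₁ ih =>
      have h1 := sz_append (f a) (l₁.flatMap f)
      have h2 := hN a (by simp)
      have h3 := ih fun b hb => hN b (by simp [hb])
      rw [List.flatMap_cons, List.length_cons]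
      nlinarith
  have := foldl (l := l) (c := fun _ => ([] : List γ)) (f := fun x c b => c ++ f x b) hl
    (by fun_prop)
    (append (by fun_prop) (hf.comp (f := fun x : α × β => f x.1 x.2)
        (g := fun s : α × List γ × β => (s.1, s.2.2)) (by fun_prop)))
    (P * Q.comp (X + P + 1) + 1) fun x l₁ l₂ h => by
      rw [key, List.nil_append]
      have h1 := hs (f x) l₁ (Q.eval (sz x + P.eval (sz x) + 1)) fun b hb => by
        refine (hQ (x, b)).trans (eval_mono Q ?_)
        rw [sz_mk]
        have h3 : sz b ≤ sz (l x) := sz_le_of_mem (by rw [h]; simp [hb])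
        have := hP x
        omega
      refine h1.trans ?_
      simp only [eval_add, eval_mul, eval_comp, eval_X, eval_one]
      have h4 : l₁.length ≤ P.eval (sz x) := by
        have h5 := length_lt_sz (l x)
        have h6 := hP x
        rw [h, List.length_append] at h5
        rw [h] at h6
        omega
      exact Nat.add_le_add_right (Nat.mul_le_mul_right _ h4) 1
  exact this.of_enc fun x => by rw [key, List.nil_append]

@[fun_prop]
theorem map {l : α → List β} {f : α → β → γ} (hl : Poly l)
    (hf : Poly (fun x : α × β => f x.1 x.2)) : Poly (fun x => (l x).map (f x)) := by
  have : Poly (fun x => (l x).flatMap fun b => [f x b]) := by fun_prop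
  exact this.of_enc fun x => by rw [← List.map_eq_flatMap]

@[fun_prop]
theorem filter {l : α → List β} {f : α → β → Bool} (hl : Poly l)
    (hf : Poly (fun x : α × β => f x.1 x.2)) : Poly (fun x => (l x).filter (f x)) := by
  have : Poly (fun x => (l x).flatMap fun b => cond (f x b) [b] []) := by fun_prop
  refine this.of_enc fun x => ?_
  congr 1
  induction l x with
  | nil => rfl
  | cons a l ih => cases h : f x a <;> simp [h, ih]

@[fun_prop]
theorem isEmpty {l : α → List β} (hl : Poly l) : Poly (fun x => (l x).isEmpty) := by
  have : Poly (fun x => GenReach.listCases (l x) true fun _ _ => false) := by fun_prop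
  exact this.of_enc fun x => by cases l x <;> rfl

@[fun_prop]
theorem any {l : α → List β} {f : α → β → Bool} (hl : Poly l)
    (hf : Poly (fun x : α × β => f x.1 x.2)) : Poly (fun x => (l x).any (f x)) := by
  have : Poly (fun x => !((l x).filter (f x)).isEmpty) := by fun_prop
  refine this.of_enc fun x => ?_
  congr 1
  rw [Bool.eq_iff_iff]
  simp

@[fun_prop]
theorem all {l : α → List β} {f : α → β → Bool} (hl : Poly l)
    (hf : Poly (fun x : α × β => f x.1 x.2)) : Poly (fun x => (l x).all (f x)) := by
  have : Poly (fun x => ((l x).filter fun b => !(f x b)).isEmpty) := by fun_prop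
  refine this.of_enc fun x => ?_
  congr 1
  rw [Bool.eq_iff_iff]
  simp

end Poly
-- Equality tests, unary arithmetic and sublists in polynomial time.
/-- Equality as a boolean. -/
def eqB {β : Type} [DecidableEq β] (a b : β) : Bool := decide (a = b)

/-- Membership as a boolean. -/
def memB {β : Type} [DecidableEq β] (a : β) (l : List β) : Bool := decide (a ∈ l)

/-- The order of the natural numbers as a boolean. -/
def leB (m n : ℕ) : Bool := decide (m ≤ n)

@[simp] theorem eqB_eq {β : Type} [DecidableEq β] (a b : β) : eqB a b = true ↔ a = b := by
  simp [eqB]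

@[simp] theorem memB_eq {β : Type} [DecidableEq β] (a : β) (l : List β) :
    memB a l = true ↔ a ∈ l := by
  simp [memB]

@[simp] theorem leB_eq (m n : ℕ) : leB m n = true ↔ m ≤ n := by
  simp [leB]

/-- Remove the roots of the first pair of trees on a worklist, if they agree. -/
def eqStep (s : Bool × List (T × T)) : Bool × List (T × T) :=
  listCases s.2 s fun p w =>
    cond (eqB p.1 .nil) (cond (eqB p.2 .nil) (s.1, w) (false, []))
      (cond (eqB p.2 .nil) (false, []) (s.1, (p.1.car, p.2.car) :: (p.1.cdr, p.2.cdr) :: w))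

theorem eqStep_nil (b : Bool) : eqStep (b, []) = (b, []) := rfl

theorem eqStep_nil_nil (b : Bool) (w : List (T × T)) :
    eqStep (b, (.nil, .nil) :: w) = (b, w) := by
  simp [eqStep, listCases, eqB]

theorem eqStep_nil_cons (b : Bool) (x y : T) (w : List (T × T)) :
    eqStep (b, (.nil, .cons x y) :: w) = (false, []) := by
  simp [eqStep, listCases, eqB]

theorem eqStep_cons_nil (b : Bool) (x y : T) (w : List (T × T)) :
    eqStep (b, (.cons x y, .nil) :: w) = (false, []) := by
  simp [eqStep, listCases, eqB]

theorem eqStep_cons_cons (b : Bool) (x x' y y' : T) (w : List (T × T)) :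
    eqStep (b, (.cons x x', .cons y y') :: w) = (b, (x, y) :: (x', y') :: w) := by
  simp [eqStep, listCases, eqB, T.car, T.cdr]

namespace Poly

variable {α β γ δ : Type} [Enc α] [Enc β] [Enc γ] [Enc δ]

@[fun_prop]
theorem car {f : α → T} (hf : Poly f) : Poly (fun x => (f x).car) := PolyTree.car hf

@[fun_prop]
theorem cdr {f : α → T} (hf : Poly f) : Poly (fun x => (f x).cdr) := PolyTree.cdr hf

theorem eq_nil {f : α → T} (hf : Poly f) : Poly (fun x => eqB (f x) .nil) := by
  refine PolyTree.branch hf (((const false).reindex Subtype.val).congr fun x => ?_)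
    (((const true).reindex Subtype.val).congr fun x => ?_)
  · have : eqB (f x.1) .nil = false := decide_eq_false x.2
    simp only [this]
  · have : eqB (f x.1) .nil = true := decide_eq_true x.2
    simp only [this]

theorem eqStep_poly : Poly eqStep := by
  have h1 : Poly (fun x : (Bool × List (T × T)) × (T × T) × List (T × T) => eqB x.2.1.1 .nil) :=
    eq_nil (by fun_prop)
  have h2 : Poly (fun x : (Bool × List (T × T)) × (T × T) × List (T × T) => eqB x.2.1.2 .nil) :=
    eq_nil (by fun_prop)
  unfold eqStep
  fun_prop

theorem sz_eqStep_le (s : Bool × List (T × T)) : sz (eqStep s) ≤ sz s + 2 := by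
  have hb (b : Bool) : sz b ≤ 3 := by cases b <;> simp [sz, Enc.enc, T.size]
  obtain ⟨b, _ | ⟨⟨x, y⟩, w⟩⟩ := s
  · exact Nat.le_add_right _ _
  · have := hb false
    have := hb b
    rcases x with _ | ⟨x, x'⟩ <;> rcases y with _ | ⟨y, y'⟩ <;>
    · simp only [eqStep_nil_nil, eqStep_nil_cons, eqStep_cons_nil, eqStep_cons_cons, sz_mk, sz_cons,
        sz_nil]
      simp only [sz, Enc.enc, id, T.size] at *
      omega

/-- The total size of the first components on a nonempty worklist drops with every step, since each
step removes a root or empties the list. So `n` steps exhaust the worklist. -/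
theorem eqStep_iterate (n : ℕ) (s : Bool × List (T × T))
    (h : (s.2.map fun p => p.1.size).sum ≤ n) :
    (eqStep^[n] s).1 = true ↔ s.1 = true ∧ ∀ p ∈ s.2, p.1 = p.2 := by
  induction n generalizing s with
  | zero =>
    obtain ⟨b, _ | ⟨⟨x, y⟩, w⟩⟩ := s
    · simp
    · have := x.one_le_size
      simp at h
      omega
  | succ n ih =>
    rw [Function.iterate_succ_apply]
    obtain ⟨b, _ | ⟨⟨x, y⟩, w⟩⟩ := s
    · rw [eqStep_nil, ih _ (by simp)]
    · simp only [List.map_cons, List.sum_cons] at h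
      rcases x with _ | ⟨x, x'⟩ <;> rcases y with _ | ⟨y, y'⟩ <;>
      · simp only [T.size] at h
        simp only [eqStep_nil_nil, eqStep_nil_cons, eqStep_cons_nil, eqStep_cons_cons]
        rw [ih _ (by simp; try omega)]
        simp [and_assoc]

open Polynomial in
theorem eq_tree : Poly (fun x : T × T => eqB x.1 x.2) := by
  have key (s : Bool × List (T × T)) (j : ℕ) : sz (eqStep^[j] s) ≤ sz s + 2 * j := by
    induction j with
    | zero => exact le_rfl
    | succ j ih =>
      rw [Function.iterate_succ_apply']
      have := sz_eqStep_le (eqStep^[j] s)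
      omega
  have h := iterate (c := fun x : T × T => x) (g := fun x => (true, [x])) (by fun_prop)
    (by fun_prop) eqStep_poly (C 3 * X + 20) fun x j hj => by
      refine (key _ j).trans ?_
      have : sz (true, [x]) ≤ 20 + sz x := by
        simp only [sz_mk, sz_cons, sz_nil]
        have : sz true = 3 := rfl
        omega
      simp only [eval_add, eval_mul, eval_C, eval_X, eval_ofNat]
      omega
  have h2 : Poly (fun x : T × T => (eqStep^[sz x] (true, [x])).1) := by fun_prop
  refine h2.of_enc fun x => ?_
  congr 1
  rw [Bool.eq_iff_iff, eqStep_iterate _ _ ?_]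
  · simp
  · have : sz x = 1 + x.1.size + x.2.size := rfl
    simp
    omega

@[fun_prop]
theorem eqB [DecidableEq β] {f g : α → β} (hf : Poly f) (hg : Poly g) :
    Poly (fun x => eqB (f x) (g x)) := by
  have hf' : Poly (fun x => Enc.enc (f x)) := hf
  have hg' : Poly (fun x => Enc.enc (g x)) := hg
  have : Poly (fun x => GenReach.eqB (Enc.enc (f x)) (Enc.enc (g x))) := 
    eq_tree.comp (g := fun x => (Enc.enc (f x), Enc.enc (g x))) (by fun_prop)
  refine this.of_enc fun x => ?_
  congr 1
  rw [Bool.eq_iff_iff]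
  simp [Enc.inj.eq_iff]

@[fun_prop]
theorem memB [DecidableEq β] {f : α → β} {l : α → List β} (hf : Poly f) (hl : Poly l) :
    Poly (fun x => memB (f x) (l x)) := by
  have : Poly (fun x => (l x).any fun b => GenReach.eqB b (f x)) := by fun_prop
  refine this.of_enc fun x => ?_
  congr 1
  rw [Bool.eq_iff_iff]
  simp

/-- Numbers are unary and have the same trees as lists of units, so arithmetic reduces to list
operations through `of_enc`. -/
theorem enc_length {ε : Type} (l : List ε) : Enc.enc (l.map fun _ => ()) = Enc.enc l.length := by
  induction l with
  | nil => rfl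
  | cons a l ih => exact congrArg (T.cons .nil) ih

@[fun_prop]
theorem length {l : α → List β} (hl : Poly l) : Poly (fun x => (l x).length) := by
  have : Poly (fun x => (l x).map fun _ => ()) := by fun_prop
  exact this.of_enc fun x => enc_length _

theorem enc_replicate (n : ℕ) : Enc.enc n = Enc.enc (List.replicate n ()) := by
  rw [← List.length_replicate (n := n) (a := ()), ← enc_length]
  simp

theorem sz_nat (n : ℕ) : sz n = 2 * n + 1 := by
  induction n with
  | zero => rfl
  | succ n ih =>
    have : sz (n + 1) = 1 + 1 + sz n := rfl
    omega

@[fun_prop]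
theorem units {n : α → ℕ} (hn : Poly n) : Poly (fun x => List.replicate (n x) ()) :=
  hn.of_enc fun _ => enc_replicate _

@[fun_prop]
theorem add {m n : α → ℕ} (hm : Poly m) (hn : Poly n) : Poly (fun x => m x + n x) := by
  have : Poly (fun x => (List.replicate (m x) () ++ List.replicate (n x) ()).length) := by fun_prop
  exact this.of_enc fun x => by simp

theorem foldl_units {γ : Type} (f : γ → γ) (n : ℕ) (c : γ) :
    (List.replicate n ()).foldl (fun c _ => f c) c = f^[n] c := by
  induction n generalizing c with
  | zero => rfl
  | succ n ih => rw [List.replicate_succ, List.foldl_cons, ih]; rfl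

theorem iterate_nat {n : α → ℕ} {c : α → γ} {f : α → γ → γ} (hn : Poly n) (hc : Poly c)
    (hf : Poly (fun x : α × γ => f x.1 x.2)) (Q : Polynomial ℕ)
    (hQ : ∀ x, ∀ j ≤ n x, sz ((f x)^[j] (c x)) ≤ Q.eval (sz x)) :
    Poly (fun x => (f x)^[n x] (c x)) := by
  have := foldl (l := fun x => List.replicate (n x) ()) (c := c) (f := fun x c (_ : Unit) => f x c)
    (by fun_prop) hc (hf.comp (f := fun x : α × γ => f x.1 x.2)
      (g := fun s : α × γ × Unit => (s.1, s.2.1)) (by fun_prop)) Q fun x l₁ l₂ h => by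
    obtain ⟨h1, h2, -⟩ := List.append_eq_replicate_iff.1 h.symm
    rw [h2, foldl_units]
    exact hQ x _ (by omega)
  exact this.of_enc fun x => by rw [foldl_units]

@[fun_prop]
theorem drop {n : α → ℕ} {l : α → List β} (hn : Poly n) (hl : Poly l) :
    Poly (fun x => (l x).drop (n x)) := by
  obtain ⟨P, hP⟩ := hl.bound
  have key (l : List β) (j : ℕ) : (fun l : List β => l.tail)^[j] l = l.drop j := by
    induction j generalizing l with
    | zero => rfl
    | succ j ih => rw [Function.iterate_succ_apply, ih]; cases l <;> simp
  have := iterate_nat (f := fun _ l => l.tail) hn hl (by fun_prop) P fun x j _ => by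
    rw [key]
    exact (sz_drop_le _ _).trans (hP x)
  exact this.of_enc fun x => by rw [key]

@[fun_prop]
theorem getD {n : α → ℕ} {l : α → List β} {d : α → β} (hl : Poly l) (hn : Poly n) (hd : Poly d) :
    Poly (fun x => (l x).getD (n x) (d x)) := by
  have : Poly (fun x => GenReach.listCases ((l x).drop (n x)) (d x) fun b _ => b) := by fun_prop
  refine this.of_enc fun x => ?_
  congr 1
  rw [List.getD_eq_getElem?_getD, ← List.head?_drop]
  cases (l x).drop (n x) <;> rfl

@[fun_prop]
theorem leB {m n : α → ℕ} (hm : Poly m) (hn : Poly n) : Poly (fun x => leB (m x) (n x)) := by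
  have : Poly (fun x => ((List.replicate (m x) ()).drop (n x)).isEmpty) := by fun_prop
  refine this.of_enc fun x => ?_
  congr 1
  rw [Bool.eq_iff_iff]
  simp
  omega

open Polynomial in
@[fun_prop]
theorem range {n : α → ℕ} (hn : Poly n) : Poly (fun x => List.range (n x)) := by
  obtain ⟨P, hP⟩ := hn.bound
  have key (j : ℕ) : (fun l : List ℕ => l ++ [l.length])^[j] [] = List.range j := by
    induction j with
    | zero => rfl
    | succ j ih => rw [Function.iterate_succ_apply', ih, List.range_succ, List.length_range]
  have := iterate_nat (c := fun _ => []) (f := fun _ (l : List ℕ) => l ++ [l.length]) hn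
    (by fun_prop) (by fun_prop) (P * (P + 1) + 1) fun x j hj => by
    rw [key]
    refine (sz_le_length_mul (N := P.eval (sz x)) fun a ha => ?_).trans ?_
    · have h1 := List.mem_range.1 ha
      have h2 := hP x
      rw [sz_nat] at h2 ⊢
      omega
    · rw [List.length_range]
      simp only [eval_add, eval_mul, eval_one]
      have h2 := hP x
      rw [sz_nat] at h2
      exact Nat.add_le_add_right (Nat.mul_le_mul_right _ (by omega)) 1
  exact this.of_enc fun x => by rw [key]

open Polynomial in
@[fun_prop]
theorem log2 {n : α → ℕ} (hn : Poly n) : Poly (fun x => Nat.log 2 (n x)) := by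
  obtain ⟨P, hP⟩ := hn.bound
  let f (n : ℕ) (s : ℕ × ℕ) : ℕ × ℕ :=
    cond (GenReach.leB (s.1 + s.1) n) (s.1 + s.1, s.2 + 1) s
  -- The first component is doubled as long as it stays at most `n`; after `n ≥ Nat.log 2 n` rounds
  -- the second component has reached the logarithm.
  have key (n j : ℕ) : (f n)^[j] (1, 0) = (2 ^ min j (Nat.log 2 n), min j (Nat.log 2 n)) := by
    induction j with
    | zero => simp
    | succ j ih =>
      rw [Function.iterate_succ_apply', ih]
      rcases lt_or_ge j (Nat.log 2 n) with h | h
      · have h0 : n ≠ 0 := by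
          rintro rfl
          simp at h
        have h1 : 2 ^ (j + 1) ≤ n := Nat.pow_le_of_le_log h0 h
        rw [min_eq_left h.le, min_eq_left h]
        rw [pow_succ] at h1
        simp only [f, GenReach.leB]
        rw [decide_eq_true (by omega), cond_true, pow_succ]
        congr 1
        omega
      · have h1 : n < 2 ^ (Nat.log 2 n + 1) := Nat.lt_pow_succ_log_self (by norm_num) n
        rw [min_eq_right h, min_eq_right (by omega)]
        rw [pow_succ] at h1
        simp only [f, GenReach.leB]
        rw [decide_eq_false (by omega), cond_false]
  have h := iterate_nat (c := fun _ => (1, 0)) (f := fun x => f (n x)) hn (by fun_prop)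
    (by fun_prop) (C 3 * P + 7) fun x j _ => by
      rw [key, sz_mk, sz_nat, sz_nat]
      have h1 := hP x
      rw [sz_nat] at h1
      have h2 : 2 ^ min j (Nat.log 2 (n x)) ≤ n x + 1 := by
        rcases Nat.eq_zero_or_pos (n x) with h | h
        · simp [h]
        · exact (Nat.pow_le_of_le_log (by omega) (min_le_right _ _)).trans (Nat.le_succ _)
      have h3 : min j (Nat.log 2 (n x)) ≤ n x := (min_le_right _ _).trans (Nat.log_le_self _ _)
      simp only [eval_add, eval_mul, eval_C, eval_ofNat]
      omega
  have h2 : Poly (fun x => ((f (n x))^[n x] (1, 0)).2) := by fun_prop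
  refine h2.of_enc fun x => ?_
  rw [key, min_eq_right (Nat.log_le_self _ _)]

@[fun_prop]
theorem constMul (c : ℕ) {n : α → ℕ} (hn : Poly n) : Poly (fun x => c * n x) := by
  induction c with
  | zero => simpa using const 0
  | succ c ih =>
    have : Poly (fun x => c * n x + n x) := by fun_prop
    exact this.of_enc fun x => by rw [Nat.succ_mul]

theorem sz_le_of_sublist {l m : List β} (h : l.Sublist m) : sz l ≤ sz m := by
  induction h with
  | slnil => exact le_rfl
  | cons a h ih => rw [sz_cons]; omega
  | cons_cons a h ih => rw [sz_cons, sz_cons]; omega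

open Polynomial in
-- The output has `2 ^ (l x).length` entries, hence the hypothesis `hQ`. It is met below because
-- only logarithmically long lists are passed.
theorem sublists' {l : α → List β} (hl : Poly l) (Q : Polynomial ℕ)
    (hQ : ∀ x, 2 ^ (l x).length ≤ Q.eval (sz x)) : Poly (fun x => (l x).sublists') := by
  obtain ⟨P, hP⟩ := hl.bound
  have key (l : List β) :
      l.foldr (fun b (c : List (List β)) => c ++ c.map fun m => b :: m) [[]] = l.sublists' := by
    induction l with
    | nil => rfl
    | cons a l ih => rw [List.foldr_cons, ih, List.sublists'_cons]
  have key' (l : List β) :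
      l.foldl (fun (c : List (List β)) b => c ++ c.map fun m => b :: m) [[]] =
        l.reverse.sublists' := by
    rw [← key, List.foldr_reverse]
  have := foldl (l := fun x => (l x).reverse) (c := fun _ => ([[]] : List (List β)))
    (f := fun _ c b => c ++ c.map fun m => b :: m) (by fun_prop) (by fun_prop) (by fun_prop)
    (Q * (P + 1) + 1) fun x l₁ l₂ h => by
      rw [key']
      have h1 : l x = l₂.reverse ++ l₁.reverse := by
        rw [← List.reverse_append, ← h, List.reverse_reverse]
      refine (sz_le_length_mul (N := P.eval (sz x)) fun a ha => ?_).trans ?_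
      · refine le_trans (sz_le_of_sublist ?_) (hP x)
        rw [h1]
        exact (List.mem_sublists'.1 ha).trans (List.sublist_append_right _ _)
      · simp only [eval_add, eval_mul, eval_one, List.length_sublists']
        refine Nat.add_le_add_right (Nat.mul_le_mul_right _ (le_trans ?_ (hQ x))) 1
        refine Nat.pow_le_pow_right (by norm_num) ?_
        rw [h1, List.length_append]
        omega
  exact this.of_enc fun x => by rw [key', List.reverse_reverse]

end Poly
/-! ### Reachability games -/

/-- A reachability game: the final positions, the positions of Eve, and the moves. -/
structure ReachGame (S : Type) where
  fin : S → Prop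
  eve : S → Prop
  move : S → S → Prop

namespace ReachGame

variable {S : Type}

/-- The positions from which Eve can force a visit to a final position. -/
inductive Wins (g : ReachGame S) : S → Prop
  | final {p} : g.fin p → Wins g p
  | eve {p q} : g.eve p → g.move p q → Wins g q → Wins g p
  | adam {p} : ¬ g.eve p → (∀ q, g.move p q → Wins g q) → Wins g p

/-- The positions from which Eve can force a visit to a final position within fewer than `n`
moves. -/
def WinsIn (g : ReachGame S) : ℕ → S → Prop
  | 0, _ => False
  | n + 1, p => g.fin p ∨ (g.eve p ∧ ∃ q, g.move p q ∧ g.WinsIn n q) ∨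
      (¬ g.eve p ∧ ∀ q, g.move p q → g.WinsIn n q)

variable {g : ReachGame S}

theorem WinsIn.succ {n : ℕ} {p : S} (h : g.WinsIn n p) : g.WinsIn (n + 1) p := by
  induction n generalizing p with
  | zero => exact h.elim
  | succ n ih =>
    rcases h with h | ⟨h, q, hq, h'⟩ | ⟨h, h'⟩
    · exact .inl h
    · exact .inr (.inl ⟨h, q, hq, ih h'⟩)
    · exact .inr (.inr ⟨h, fun q hq => ih (h' q hq)⟩)

theorem WinsIn.mono {n m : ℕ} {p : S} (h : g.WinsIn n p) (hnm : n ≤ m) : g.WinsIn m p := by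
  induction hnm with
  | refl => exact h
  | step _ ih => exact ih.succ

theorem WinsIn.wins {n : ℕ} {p : S} (h : g.WinsIn n p) : g.Wins p := by
  induction n generalizing p with
  | zero => exact h.elim
  | succ n ih =>
    rcases h with h | ⟨h, q, hq, h'⟩ | ⟨h, h'⟩
    · exact .final h
    · exact .eve h hq (ih h')
    · exact .adam h fun q hq => ih (h' q hq)

/-- At a position of Adam the bounds of all successors are combined by a supremum, which is where
finite branching enters. -/
theorem Wins.winsIn (hfin : ∀ p, {q | g.move p q}.Finite) {p : S} (h : g.Wins p) :
    ∃ n, g.WinsIn n p := by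
  induction h with
  | final h => exact ⟨1, .inl h⟩
  | eve h hq _ ih =>
    obtain ⟨n, hn⟩ := ih
    exact ⟨n + 1, .inr (.inl ⟨h, _, hq, hn⟩)⟩
  | @adam p h _ ih =>
    choose! n hn using ih
    refine ⟨(hfin p).toFinset.sup n + 1, .inr (.inr ⟨h, fun q hq => (hn q hq).mono ?_⟩)⟩
    exact Finset.le_sup (f := n) (by simpa using hq)

/-- The moves from `φ p` are exactly the images of the moves from `p`, so `φ` is a functional
bisimulation. Neither injectivity nor surjectivity is needed. -/
theorem wins_iff_of_map {S' : Type} {g' : ReachGame S'} (φ : S → S')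
    (hfin : ∀ p, g'.fin (φ p) ↔ g.fin p) (heve : ∀ p, g'.eve (φ p) ↔ g.eve p)
    (hmove : ∀ p q', g'.move (φ p) q' ↔ ∃ q, g.move p q ∧ φ q = q') (p : S) :
    g'.Wins (φ p) ↔ g.Wins p := by
  constructor
  · intro h
    generalize hp : φ p = p' at h
    induction h generalizing p with
    | final h =>
      subst hp
      exact .final ((hfin p).1 h)
    | eve h hq _ ih =>
      subst hp
      obtain ⟨q, hq', rfl⟩ := (hmove _ _).1 hq
      exact .eve ((heve p).1 h) hq' (ih q rfl)
    | adam h _ ih =>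
      subst hp
      exact .adam (fun h' => h ((heve p).2 h')) fun q hq => ih _ ((hmove _ _).2 ⟨q, hq, rfl⟩) q rfl
  · intro h
    induction h with
    | final h => exact .final ((hfin _).2 h)
    | eve h hq _ ih => exact .eve ((heve _).2 h) ((hmove _ _).2 ⟨_, hq, rfl⟩) ih
    | adam h _ ih =>
      refine .adam (fun h' => h ((heve _).1 h')) fun q' hq => ?_
      obtain ⟨q, hq', rfl⟩ := (hmove _ _).1 hq
      exact ih q hq'

end ReachGame

/-! ### Generalised reachability as a reachability game -/

namespace Game

variable {V : Type} (G : Game V)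

open Classical in
/-- The positions consist of the current vertex and the target sets that have not been visited. -/
def remaining : ReachGame (V × List (Finset V)) where
  fin p := p.2 = []
  eve p := G.owner p.1 = .eve
  move p q := (p.1, q.1) ∈ G.edges ∧ q.2 = p.2.filter (fun F => q.1 ∉ F)

open Classical in
/-- The target sets that are disjoint from a history. -/
noncomputable def unvisited (past : List V) (v : V) : List (Finset V) :=
  G.targets.filter (fun F => ∀ u ∈ past ++ [v], u ∉ F)

open Classical in
theorem unvisited_append (past : List V) (v w : V) :
    G.unvisited (past ++ [v]) w = (G.unvisited past v).filter (fun F => w ∉ F) := by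
  unfold unvisited
  rw [List.filter_filter]
  refine List.filter_congr fun F _ => ?_
  simp only [List.mem_append, List.mem_singleton, ← Bool.decide_and]
  rw [decide_eq_decide]
  grind

variable {G}

theorem history_mem (σ : Strategy G.toArena .eve) (τ : Strategy G.toArena .adam) (i : ℕ) (u : V)
    (hu : u ∈ (G.history σ τ i).1 ++ [(G.history σ τ i).2]) : ∃ j ≤ i, G.play σ τ j = u := by
  induction i with
  | zero =>
    refine ⟨0, le_rfl, ?_⟩
    simpa [history, play, eq_comm] using hu
  | succ i ih =>
    rcases List.mem_append.1 hu with hu | hu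
    · obtain ⟨j, hj, h⟩ := ih hu
      exact ⟨j, by omega, h⟩
    · exact ⟨i + 1, le_rfl, (List.mem_singleton.1 hu).symm⟩

theorem mem_history (σ : Strategy G.toArena .eve) (τ : Strategy G.toArena .adam) {i j : ℕ}
    (hj : j ≤ i) : G.play σ τ j ∈ (G.history σ τ i).1 ++ [(G.history σ τ i).2] := by
  induction hj with
  | refl => simp [play]
  | step _ ih => exact List.mem_append_left _ ih

theorem unvisited_eq_nil (σ : Strategy G.toArena .eve) (τ : Strategy G.toArena .adam) (i : ℕ) :
    G.unvisited (G.history σ τ i).1 (G.history σ τ i).2 = [] ↔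
      ∀ F ∈ G.targets, ∃ j ≤ i, G.play σ τ j ∈ F := by
  unfold unvisited
  rw [List.filter_eq_nil_iff]
  refine forall₂_congr fun F _ => ?_
  simp only [decide_eq_true_eq, not_forall, not_not, exists_prop]
  constructor
  · rintro ⟨u, hu, h⟩
    obtain ⟨j, hj, rfl⟩ := history_mem σ τ i u hu
    exact ⟨j, hj, h⟩
  · rintro ⟨j, hj, h⟩
    exact ⟨_, mem_history σ τ hj, h⟩

/-- A good successor is chosen where one exists and an arbitrary successor elsewhere; the absence of
dead ends makes the latter possible. -/
theorem exists_strategy (A : Arena V) (p : Player) (P : List V → V → V → Prop) :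
    ∃ σ : Strategy A p, ∀ past v, (∃ w, (v, w) ∈ A.edges ∧ P past v w) →
      P past v (σ.move past v) := by
  have (past : List V) (v : V) : ∃ w, (v, w) ∈ A.edges ∧
      ((∃ w, (v, w) ∈ A.edges ∧ P past v w) → P past v w) := by
    by_cases h : ∃ w, (v, w) ∈ A.edges ∧ P past v w
    · obtain ⟨w, hw, h'⟩ := h
      exact ⟨w, hw, fun _ => h'⟩
    · obtain ⟨w, hw⟩ := A.exists_succ v
      exact ⟨w, hw, fun h' => absurd h' h⟩
  choose m hm hm' using this
  exact ⟨⟨m, fun past v _ => hm past v⟩, hm'⟩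

open Classical in
theorem eveWins_of_winsIn {n : ℕ}
    (h : G.remaining.WinsIn n (G.start, G.unvisited [] G.start)) : G.EveWins := by
  -- Eve moves to a successor of least rank, where the rank is the least `n` for which `WinsIn n`
  -- holds. The strategy then depends only on the history, and the rank bound decreases along every
  -- play.
  obtain ⟨σ, hσ⟩ := exists_strategy G.toArena .eve fun past v w => ∀ n,
    (∃ w', (v, w') ∈ G.edges ∧ G.remaining.WinsIn n (w', G.unvisited (past ++ [v]) w')) →
      G.remaining.WinsIn n (w, G.unvisited (past ++ [v]) w)
  refine ⟨σ, fun τ => ?_⟩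
  have key (n : ℕ) : ∀ i, G.remaining.WinsIn n
      ((G.history σ τ i).2, G.unvisited (G.history σ τ i).1 (G.history σ τ i).2) →
      ∃ k, G.unvisited (G.history σ τ k).1 (G.history σ τ k).2 = [] := by
    induction n with
    | zero => exact fun i h => h.elim
    | succ n ih =>
      rintro i (h | ⟨h, ⟨w, R⟩, ⟨hw, hR⟩, h'⟩ | ⟨h, h'⟩)
      · exact ⟨i, h⟩
      · refine ih (i + 1) ?_
        simp only [remaining] at h hw h' hR
        rw [hR, ← unvisited_append] at h'
        have hmove : G.next σ τ (G.history σ τ i).1 (G.history σ τ i).2 =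
            σ.move (G.history σ τ i).1 (G.history σ τ i).2 := by
          unfold next
          rw [h]
        have hex : ∃ m, ∃ w', ((G.history σ τ i).2, w') ∈ G.edges ∧ G.remaining.WinsIn m
            (w', G.unvisited ((G.history σ τ i).1 ++ [(G.history σ τ i).2]) w') :=
          ⟨n, w, hw, h'⟩
        simp only [history, hmove]
        refine hσ _ _ ?_ n ⟨w, hw, h'⟩
        obtain ⟨w', hw', h''⟩ := Nat.find_spec hex
        exact ⟨w', hw', fun m hm => h''.mono (Nat.find_min' hex hm)⟩
      · refine ih (i + 1) ?_
        simp only [remaining] at h h'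
        have hmove : G.next σ τ (G.history σ τ i).1 (G.history σ τ i).2 =
            τ.move (G.history σ τ i).1 (G.history σ τ i).2 := by
          unfold next
          cases ho : G.owner (G.history σ τ i).2
          · exact absurd ho h
          · rfl
        have hadam : G.owner (G.history σ τ i).2 = .adam := by
          cases ho : G.owner (G.history σ τ i).2
          · exact absurd ho h
          · rfl
        refine h' (_, _) ⟨?_, ?_⟩
        · simp only [history, hmove]
          exact τ.legal _ _ hadam
        · simp only [history]
          rw [unvisited_append]
          rfl
  obtain ⟨k, hk⟩ := key n 0 h
  exact ⟨k, (unvisited_eq_nil σ τ k).1 hk⟩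

open Classical in
theorem wins_of_eveWins (h : G.EveWins) :
    G.remaining.Wins (G.start, G.unvisited [] G.start) := by
  by_contra hn
  obtain ⟨σ, hσ⟩ := h
  -- Adam stays outside Eve's winning region: from a position that is not winning he has a successor
  -- that is not winning, and Eve has only such successors.
  obtain ⟨τ, hτ⟩ := exists_strategy G.toArena .adam fun past v w =>
    ¬ G.remaining.Wins (w, G.unvisited (past ++ [v]) w)
  have key (i : ℕ) : ¬ G.remaining.Wins
      ((G.history σ τ i).2, G.unvisited (G.history σ τ i).1 (G.history σ τ i).2) := by
    induction i with
    | zero => exact hn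
    | succ i ih =>
      intro h
      refine ih ?_
      simp only [history] at h
      cases ho : G.owner (G.history σ τ i).2 with
      | eve =>
        simp only [next, ho] at h
        refine .eve (q := (_, _)) ho ⟨σ.legal _ _ ho, ?_⟩ h
        simp only
        rw [unvisited_append]
      | adam =>
        refine .adam (by simp [remaining, ho]) ?_
        rintro ⟨w, R⟩ ⟨hw, hR⟩
        simp only [next, ho] at h
        by_contra hc
        simp only at hc hw hR
        rw [hR, ← unvisited_append] at hc
        exact hτ _ _ ⟨w, hw, hc⟩ h
  obtain ⟨k, hk⟩ := hσ τ
  exact key k (.final ((unvisited_eq_nil σ τ k).2 hk))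

theorem eveWins_iff [Finite V] :
    G.EveWins ↔ G.remaining.Wins (G.start, G.unvisited [] G.start) := by
  refine ⟨wins_of_eveWins, fun h => ?_⟩
  obtain ⟨n, hn⟩ := h.winsIn fun p => by
    classical
    refine (Set.finite_range fun w : V => (w, p.2.filter fun F => w ∉ F)).subset ?_
    rintro ⟨w, R⟩ ⟨-, hR⟩
    refine ⟨w, ?_⟩
    simp only at hR
    rw [hR]
  exact eveWins_of_winsIn hn

end Game

/-! ### Reduction of singleton targets to a chain -/

section Chain

variable {V : Type} (eve : V → Prop) (move : V → V → Prop)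

/-- Reaching a single vertex. -/
def reachVertex (t : V) : ReachGame V := ⟨fun v => v = t, eve, move⟩

variable {eve move} in
theorem reachVertex_trans {u v t : V} (h : (reachVertex eve move u).Wins v)
    (h' : (reachVertex eve move t).Wins u) : (reachVertex eve move t).Wins v := by
  induction h with
  | final h => exact (show _ = u from h) ▸ h'
  | eve h hq _ ih => exact .eve h hq ih
  | adam h _ ih => exact .adam h ih

variable [DecidableEq V]

/-- Reaching all target sets. The positions consist of the current vertex and the target sets that
remain to be visited. -/
def reachAll : ReachGame (V × List (List V)) where
  fin p := p.2 = []
  eve p := eve p.1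
  move p q := move p.1 q.1 ∧ q.2 = p.2.filter (fun F => !memB q.1 F)

variable (sing : List V) (f : V → V → Bool)

/-- The singletons that remain after a visit of `w`, if `Q` remained before and Eve visits first the
vertices from which she can force all others. Here `f u v` tells whether Eve can force a visit to
`v` from `u`. -/
def visit (w : V) (Q : List V) : List V :=
  cond (memB w Q && Q.all (f w)) (sing.filter fun u => !f u w) Q

/-- Reaching all target sets, where the singletons are visited in the order of the forcing relation.
The positions consist of the current vertex, the non-singletons that remain to be visited, and the
singletons that remain to be visited. -/
def reachChain : ReachGame (V × List (List V) × List V) where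
  fin p := p.2.1 = [] ∧ p.2.2 = []
  eve p := eve p.1
  move p q := move p.1 q.1 ∧ q.2.1 = p.2.1.filter (fun F => !memB q.1 F) ∧
    q.2.2 = visit sing f q.1 p.2.2

variable {eve move sing f}

/-- The target sets that remain after a visit of `w`. -/
abbrev unmet (w : V) (R : List (List V)) : List (List V) := R.filter fun F => !memB w F

theorem mem_unmet {w : V} {R : List (List V)} {F : List V} : F ∈ unmet w R ↔ F ∈ R ∧ w ∉ F := by
  simp [memB]

theorem reachAll_eve {v w : V} {R : List (List V)} (hv : eve v) (hw : move v w)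
    (h : (reachAll eve move).Wins (w, unmet w R)) : (reachAll eve move).Wins (v, R) :=
  .eve hv ⟨hw, rfl⟩ h

theorem reachAll_adam {v : V} {R : List (List V)} (hv : ¬ eve v)
    (h : ∀ w, move v w → (reachAll eve move).Wins (w, unmet w R)) :
    (reachAll eve move).Wins (v, R) := by
  refine .adam hv fun p hp => ?_
  obtain ⟨w, R'⟩ := p
  obtain ⟨hw, hR⟩ := hp
  simp only at hw hR
  rw [hR]
  exact h w hw

/-- The induction steps also receive the win at the successors, since `ChainInv.visit` uses it in
addition to the induction hypothesis. -/
theorem reachAll_induction {C : V → List (List V) → Prop} (final : ∀ v, C v [])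
    (eve' : ∀ v w R, eve v → move v w → (reachAll eve move).Wins (w, unmet w R) →
      C w (unmet w R) → C v R)
    (adam : ∀ v R, ¬ eve v → (∀ w, move v w → (reachAll eve move).Wins (w, unmet w R)) →
      (∀ w, move v w → C w (unmet w R)) → C v R)
    {v : V} {R : List (List V)} (h : (reachAll eve move).Wins (v, R)) : C v R := by
  suffices ∀ p, (reachAll eve move).Wins p → C p.1 p.2 from this _ h
  intro p h
  induction h with
  | @final p h =>
    have : p.2 = [] := h
    rw [this]
    exact final _
  | @eve p q h hq h' ih =>
    obtain ⟨w, R'⟩ := q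
    obtain ⟨hw, hR⟩ := hq
    simp only at hw hR
    subst hR
    exact eve' _ _ _ h hw h' ih
  | @adam p h h' ih =>
    exact adam _ _ h (fun w hw => h' (w, _) ⟨hw, rfl⟩) fun w hw => ih (w, _) ⟨hw, rfl⟩

theorem reachChain_induction {C : V → List (List V) → List V → Prop} (final : ∀ v, C v [] [])
    (eve' : ∀ v w S Q, eve v → move v w → C w (unmet w S) (visit sing f w Q) → C v S Q)
    (adam : ∀ v S Q, ¬ eve v → (∀ w, move v w → C w (unmet w S) (visit sing f w Q)) → C v S Q)
    {v : V} {S : List (List V)} {Q : List V} (h : (reachChain eve move sing f).Wins (v, S, Q)) :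
    C v S Q := by
  suffices ∀ p, (reachChain eve move sing f).Wins p → C p.1 p.2.1 p.2.2 from this _ h
  intro p h
  induction h with
  | @final p h =>
    have : p.2.1 = [] ∧ p.2.2 = [] := h
    rw [this.1, this.2]
    exact final _
  | @eve p q h hq h' ih =>
    obtain ⟨w, S', Q'⟩ := q
    obtain ⟨hw, hS, hQ⟩ := hq
    simp only at hw hS hQ
    subst hS hQ
    exact eve' _ _ _ _ h hw ih
  | @adam p h h' ih =>
    exact adam _ _ _ h fun w hw => ih (w, _, _) ⟨hw, rfl, rfl⟩

/-- Eve first forces `u` and then plays for the targets. Which of them were met on the way is not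
under her control, so she must be able to continue from `u` with any sublist `R'` of what remained.
-/
theorem reachAll_of_reachVertex {u v : V} (h : (reachVertex eve move u).Wins v) :
    ∀ R, (∀ R' ⊆ R, (reachAll eve move).Wins (u, unmet u R')) →
      (reachAll eve move).Wins (v, unmet v R) := by
  induction h with
  | final h =>
    intro R hR
    obtain rfl : _ = u := h
    exact hR R (List.Subset.refl _)
  | eve h hq _ ih =>
    intro R hR
    exact reachAll_eve h hq (ih _ fun R' h' => hR R' fun F hF => List.mem_of_mem_filter (h' hF))
  | adam h _ ih =>
    intro R hR
    exact reachAll_adam h fun w hw => ih w hw _ fun R' h' =>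
      hR R' fun F hF => List.mem_of_mem_filter (h' hF)

/-- A strategy that visits all targets visits `u` when the singleton of `u` is among them; it is
followed until `u` is reached. -/
theorem reachVertex_of_reachAll {u w : V} {R : List (List V)}
    (h : (reachAll eve move).Wins (w, R)) : [u] ∈ R → (reachVertex eve move u).Wins w := by
  refine reachAll_induction (C := fun w R => [u] ∈ R → (reachVertex eve move u).Wins w)
    (fun v hu => ?_) (fun v w R hv hw _ ih hu => ?_) (fun v R hv _ ih hu => ?_) h
  · simp at hu
  · refine .eve hv hw ?_
    by_cases h : w = u
    · exact .final h
    · exact ih (mem_unmet.2 ⟨hu, by simpa using h⟩)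
  · refine .adam hv fun w hw => ?_
    by_cases h : w = u
    · exact .final h
    · exact ih w hw (mem_unmet.2 ⟨hu, by simpa using h⟩)

/-- Every vertex of `L` is mutually forceable with `w`, so Eve makes a round trip to each of them
before she continues with the strategy given by `h`. -/
theorem reachAll_tour {w : V} {B L : List V} {S : List (List V)}
    (hL : ∀ u ∈ L, (reachVertex eve move u).Wins w ∧ (reachVertex eve move w).Wins u)
    (h : ∀ R, (∀ F ∈ R, F ∈ S ∨ ∃ u ∈ B, F = [u]) → (reachAll eve move).Wins (w, R)) :
    ∀ R, (∀ F ∈ R, w ∉ F → F ∈ S ∨ (∃ u ∈ B, F = [u]) ∨ ∃ u ∈ L, F = [u]) →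
      (reachAll eve move).Wins (w, unmet w R) := by
  induction L with
  | nil =>
    intro R hR
    refine h _ fun F hF => ?_
    obtain ⟨h1, h2⟩ := mem_unmet.1 hF
    simpa using hR F h1 h2
  | cons u L ih =>
    intro R hR
    refine reachAll_of_reachVertex (hL u (by simp)).1 R fun R' hR' => ?_
    -- Idempotence puts the position into the form required by `reachAll_of_reachVertex` for the way
    -- back, while recording that the singleton of `u` has been met.
    have e : unmet u R' = unmet u (unmet u R') := by simp [unmet]
    rw [e]
    refine reachAll_of_reachVertex (hL u (by simp)).2 _ fun R'' hR'' => ?_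
    refine ih (fun u hu => hL u (by simp [hu])) R'' fun F hF hwF => ?_
    obtain ⟨h1, h2⟩ := mem_unmet.1 (hR'' hF)
    rcases hR F (hR' h1) hwF with h1 | h1 | ⟨v, hv, rfl⟩
    · exact .inl h1
    · exact .inr (.inl h1)
    · rcases List.mem_cons.1 hv with rfl | hv
      · simp at h2
      · exact .inr (.inr ⟨v, hv, rfl⟩)

theorem visit_subset {w : V} {Q : List V} (hQ : Q ⊆ sing) : visit sing f w Q ⊆ sing := by
  unfold visit
  cases memB w Q && Q.all (f w)
  · exact hQ
  · exact fun u hu => List.mem_of_mem_filter hu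

/-- A singleton dropped by `visit` can be forced from `w` by the guard and forces `w` by the filter,
so the dropped ones are collected by `reachAll_tour`. Quantifying over all `R` covered by `S` and
`Q` allows for targets met by accident. -/
theorem reachAll_of_visit (hf : ∀ u v, f u v = true ↔ (reachVertex eve move v).Wins u)
    {w : V} {S : List (List V)} {Q : List V} (hQ : Q ⊆ sing)
    (h : ∀ R, (∀ F ∈ R, F ∈ unmet w S ∨ ∃ u ∈ visit sing f w Q, F = [u]) →
      (reachAll eve move).Wins (w, R))
    (R : List (List V)) (hR : ∀ F ∈ R, F ∈ S ∨ ∃ u ∈ Q, F = [u]) :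
    (reachAll eve move).Wins (w, unmet w R) := by
  refine reachAll_tour (L := Q.filter fun u => !memB u (visit sing f w Q)) (fun u hu => ?_) h R
    fun F hF hwF => ?_
  · simp only [List.mem_filter, Bool.not_eq_true', memB, decide_eq_false_iff_not] at hu
    obtain ⟨hu, hu'⟩ := hu
    unfold visit at hu'
    cases hc : memB w Q && Q.all (f w) with
    | false =>
      rw [hc, cond_false] at hu'
      exact absurd hu hu'
    | true =>
      rw [hc, cond_true] at hu'
      simp only [Bool.and_eq_true, memB_eq, List.all_eq_true] at hc
      refine ⟨(hf _ _).1 (hc.2 u hu), (hf _ _).1 ?_⟩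
      by_contra hc'
      exact hu' (List.mem_filter.2 ⟨hQ hu, by simpa using hc'⟩)
  · rcases hR F hF with h1 | ⟨u, hu, rfl⟩
    · exact .inl (mem_unmet.2 ⟨h1, hwF⟩)
    · by_cases hu' : u ∈ visit sing f w Q
      · exact .inr (.inl ⟨u, hu', rfl⟩)
      · exact .inr (.inr ⟨u, by simp [hu, memB, hu'], rfl⟩)

theorem reachAll_of_reachChain (hf : ∀ u v, f u v = true ↔ (reachVertex eve move v).Wins u)
    {v : V} {S : List (List V)} {Q : List V} (h : (reachChain eve move sing f).Wins (v, S, Q)) :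
    Q ⊆ sing → ∀ R, (∀ F ∈ R, F ∈ S ∨ ∃ u ∈ Q, F = [u]) → (reachAll eve move).Wins (v, R) := by
  refine reachChain_induction (C := fun v S Q => Q ⊆ sing → ∀ R,
    (∀ F ∈ R, F ∈ S ∨ ∃ u ∈ Q, F = [u]) → (reachAll eve move).Wins (v, R))
    (fun v _ R hR => ?_) (fun v w S Q hv hw ih hQ R hR => ?_) (fun v S Q hv ih hQ R hR => ?_) h
  · refine .final (List.eq_nil_iff_forall_not_mem.2 fun F hF => ?_)
    simpa using hR F hF
  · exact reachAll_eve hv hw (reachAll_of_visit hf hQ (ih (visit_subset hQ)) R hR)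
  · exact reachAll_adam hv fun w hw =>
      reachAll_of_visit hf hQ (ih w hw (visit_subset hQ)) R hR

/-- Every singleton that has been removed from `Q` can force all remaining ones. -/
def ChainInv (sing : List V) (f : V → V → Bool) (R S : List (List V)) (Q : List V) : Prop :=
  S ⊆ R ∧ (∀ u ∈ Q, [u] ∈ R) ∧ ∀ u ∈ sing, u ∉ Q → ∀ q ∈ Q, f u q = true

/-- If `w` is in `Q`, all other singletons of `Q` remain in a position that Eve wins from `w`, hence
she can force each of them and the guard in `visit` holds. If `w` is not in `Q`, nothing changes. -/
theorem ChainInv.visit (hf : ∀ u v, f u v = true ↔ (reachVertex eve move v).Wins u)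
    {w : V} {R S : List (List V)} {Q : List V} (h : ChainInv sing f R S Q)
    (hw : (reachAll eve move).Wins (w, unmet w R)) :
    ChainInv sing f (unmet w R) (unmet w S) (visit sing f w Q) := by
  obtain ⟨h1, h2, h3⟩ := h
  refine ⟨List.filter_subset _ h1, ?_⟩
  unfold GenReach.visit
  by_cases hwQ : w ∈ Q
  · have hww : f w w = true := (hf _ _).2 (.final rfl)
    have hall (u : V) (hu : u ∈ Q) : f w u = true := by
      by_cases huw : u = w
      · rwa [huw]
      · exact (hf _ _).2 (reachVertex_of_reachAll hw
          (mem_unmet.2 ⟨h2 u hu, by simpa using Ne.symm huw⟩))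
    have hc : (memB w Q && Q.all (f w)) = true := by simpa [hwQ] using hall
    rw [hc, cond_true]
    -- By the invariant a singleton outside `Q` forces `w`, so the filter rejects it.
    have hsub (u : V) (hu : u ∈ sing.filter fun u => !f u w) : u ∈ Q := by
      by_contra hu'
      have := List.mem_filter.1 hu
      rw [h3 u this.1 hu' w hwQ] at this
      simp at this
    refine ⟨fun u hu => mem_unmet.2 ⟨h2 u (hsub u hu), ?_⟩, fun u hu hu' q hq => ?_⟩
    · intro h
      obtain rfl : w = u := by simpa using h
      simp [hww] at hu
    · have huw : f u w = true := by
        by_contra hc'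
        exact hu' (List.mem_filter.2 ⟨hu, by simpa using hc'⟩)
      exact (hf _ _).2 (reachVertex_trans ((hf _ _).1 huw) ((hf _ _).1 (hall q (hsub q hq))))
  · have hc : (memB w Q && Q.all (f w)) = false := by simp [memB, hwQ]
    rw [hc, cond_false]
    refine ⟨fun u hu => mem_unmet.2 ⟨h2 u hu, ?_⟩, h3⟩
    intro h
    obtain rfl : w = u := by simpa using h
    exact hwQ hu

theorem reachChain_of_reachAll (hf : ∀ u v, f u v = true ↔ (reachVertex eve move v).Wins u)
    {v : V} {R : List (List V)} (h : (reachAll eve move).Wins (v, R)) :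
    ∀ S Q, ChainInv sing f R S Q → (reachChain eve move sing f).Wins (v, S, Q) := by
  refine reachAll_induction (C := fun v R => ∀ S Q, ChainInv sing f R S Q →
    (reachChain eve move sing f).Wins (v, S, Q))
    (fun v S Q hi => ?_) (fun v w R hv hw h' ih S Q hi => ?_) (fun v R hv h' ih S Q hi => ?_) h
  · refine .final ⟨List.subset_nil.1 hi.1, List.eq_nil_iff_forall_not_mem.2 fun u hu => ?_⟩
    simpa using hi.2.1 u hu
  · exact .eve (q := (w, unmet w S, visit sing f w Q)) hv ⟨hw, rfl, rfl⟩ (ih _ _ (hi.visit hf h'))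
  · refine .adam hv ?_
    rintro ⟨w, S', Q'⟩ ⟨hw, hS, hQ⟩
    simp only at hw hS hQ
    rw [hS, hQ]
    exact ih w hw _ _ (hi.visit hf (h' w hw))

/-- The game with all target sets is equivalent to the game in which the singletons are visited in
the order of the forcing relation. -/
theorem reachAll_iff_reachChain (hf : ∀ u v, f u v = true ↔ (reachVertex eve move v).Wins u)
    (R : List (List V)) (hsing : ∀ u, u ∈ sing ↔ [u] ∈ R) (s : V) :
    (reachAll eve move).Wins (s, unmet s R) ↔
      (reachChain eve move sing f).Wins
        (s, unmet s (R.filter fun F => !eqB F.length 1), visit sing f s sing) := by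
  constructor
  · intro h
    refine reachChain_of_reachAll hf h _ _ (ChainInv.visit hf ⟨?_, ?_, ?_⟩ h)
    · exact fun F hF => List.mem_of_mem_filter hF
    · exact fun u hu => (hsing u).1 hu
    · exact fun u hu hu' => absurd hu hu'
  · intro h
    refine reachAll_of_visit (sing := sing) (S := R.filter fun F => !eqB F.length 1) (Q := sing)
      hf (List.Subset.refl _)
      (reachAll_of_reachChain hf h (visit_subset (List.Subset.refl _))) R fun F hF => ?_
    by_cases hF1 : F.length = 1
    · obtain ⟨u, rfl⟩ := List.length_eq_one_iff.1 hF1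
      exact .inr ⟨u, (hsing u).2 hF, rfl⟩
    · exact .inl (List.mem_filter.2 ⟨hF, by simp [eqB, hF1]⟩)

end Chain

/-! ### Solving finite reachability games -/

section Solve

variable {S : Type} [DecidableEq S]

/-- The positions in `P` that are final or from which Eve can force a move into `X`. -/
def solveStep (P : List S) (fin eve : S → Bool) (succ : S → List S) (X : List S) : List S :=
  P.filter fun p => fin p ||
    cond (eve p) ((succ p).any fun q => memB q X) ((succ p).all fun q => memB q X)

/-- The positions in `P` from which Eve can force a visit to a final position. -/
def solve (P : List S) (fin eve : S → Bool) (succ : S → List S) : List S :=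
  (solveStep P fin eve succ)^[P.length] []

/-- The reachability game that is given by boolean functions. -/
def boolGame (fin eve : S → Bool) (succ : S → List S) : ReachGame S where
  fin p := fin p = true
  eve p := eve p = true
  move p q := q ∈ succ p

variable {P : List S} {fin eve : S → Bool} {succ : S → List S}

theorem mem_iterate_solveStep (hP : ∀ p ∈ P, ∀ q ∈ succ p, q ∈ P) (n : ℕ) {p : S} (hp : p ∈ P) :
    p ∈ (solveStep P fin eve succ)^[n] [] ↔ (boolGame fin eve succ).WinsIn n p := by
  induction n generalizing p with
  | zero => simp [ReachGame.WinsIn]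
  | succ n ih =>
    rw [Function.iterate_succ_apply']
    simp only [solveStep, List.mem_filter, hp, true_and, Bool.or_eq_true, ReachGame.WinsIn]
    refine or_congr Iff.rfl ?_
    have h1 (q : S) (hq : q ∈ succ p) :
        memB q ((solveStep P fin eve succ)^[n] []) = true ↔
          (boolGame fin eve succ).WinsIn n q := by
      rw [memB_eq, ih (hP p hp q hq)]
    simp only [boolGame] at h1 ⊢
    cases eve p
    · simp only [cond_false, List.all_eq_true, Bool.false_eq_true, not_false_eq_true, true_and,
        false_and, false_or]
      exact forall₂_congr h1
    · simp only [cond_true, List.any_eq_true, true_and, not_true_eq_false, false_and, or_false]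
      exact exists_congr fun q => and_congr_right (h1 q)

theorem solveStep_mono {X Y : List S} (h : X ⊆ Y) :
    (solveStep P fin eve succ X).Sublist (solveStep P fin eve succ Y) := by
  refine List.monotone_filter_right P fun p => ?_
  simp only [Bool.or_eq_true]
  refine Or.imp_right fun h' => ?_
  cases hp : eve p
  · simp only [hp, cond_false, List.all_eq_true, memB_eq] at h' ⊢
    exact fun q hq => h (h' q hq)
  · simp only [hp, cond_true, List.any_eq_true, memB_eq] at h' ⊢
    exact h'.imp fun q hq => ⟨hq.1, h hq.2⟩

/-- Sublists are used instead of inclusion because a sublist of equal length is equal, which turns a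
count of lengths into stabilisation. -/
theorem iterate_solveStep_sublist (n : ℕ) :
    ((solveStep P fin eve succ)^[n] []).Sublist ((solveStep P fin eve succ)^[n + 1] []) := by
  induction n with
  | zero => exact List.nil_sublist _
  | succ n ih =>
    rw [Function.iterate_succ_apply', Function.iterate_succ_apply' (n := n + 1)]
    exact solveStep_mono ih.subset

theorem iterate_solveStep_sublist_self (n : ℕ) :
    ((solveStep P fin eve succ)^[n] []).Sublist P := by
  cases n with
  | zero => exact List.nil_sublist _
  | succ n =>
    rw [Function.iterate_succ_apply']
    exact List.filter_sublist

theorem iterate_solveStep_stable (n : ℕ) :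
    (solveStep P fin eve succ)^[P.length + n] [] = (solveStep P fin eve succ)^[P.length] [] := by
  -- Until two consecutive iterates agree, the length grows by at least one per round; as sublists
  -- of `P` they cannot reach length `P.length + 1`.
  have key (i : ℕ) :
      (∃ j < i, (solveStep P fin eve succ)^[j + 1] [] = (solveStep P fin eve succ)^[j] []) ∨
        i ≤ ((solveStep P fin eve succ)^[i] []).length := by
    induction i with
    | zero => exact .inr (Nat.zero_le _)
    | succ i ih =>
      rcases ih with ⟨j, hj, h⟩ | h
      · exact .inl ⟨j, by omega, h⟩
      · have h1 := iterate_solveStep_sublist (P := P) (fin := fin) (eve := eve) (succ := succ) i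
        rcases h1.length_le.lt_or_eq with h2 | h2
        · exact .inr (by omega)
        · exact .inl ⟨i, by omega, (h1.eq_of_length h2).symm⟩
  rcases key (P.length + 1) with ⟨j, hj, h⟩ | h
  · have stable (m : ℕ) : (solveStep P fin eve succ)^[m + j] [] =
        (solveStep P fin eve succ)^[j] [] := by
      induction m with
      | zero => rw [Nat.zero_add]
      | succ m ih =>
        rw [Nat.succ_add, Function.iterate_succ_apply', ih]
        exact (Function.iterate_succ_apply' _ _ _).symm.trans h
    have h1 := stable (P.length - j)
    have h2 := stable (P.length + n - j)
    rw [Nat.sub_add_cancel (by omega)] at h1 h2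
    rw [h1, h2]
  · have := (iterate_solveStep_sublist_self (P := P) (fin := fin) (eve := eve) (succ := succ)
      (P.length + 1)).length_le
    omega

theorem mem_solve (hP : ∀ p ∈ P, ∀ q ∈ succ p, q ∈ P) {p : S} (hp : p ∈ P) :
    p ∈ solve P fin eve succ ↔ (boolGame fin eve succ).Wins p := by
  rw [solve, mem_iterate_solveStep hP _ hp]
  refine ⟨fun h => h.wins, fun h => ?_⟩
  obtain ⟨n, hn⟩ := h.winsIn fun p => List.finite_toSet (succ p)
  have h1 := (mem_iterate_solveStep hP _ hp).2 (hn.mono (Nat.le_add_left n P.length))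
  rw [iterate_solveStep_stable] at h1
  exact (mem_iterate_solveStep hP _ hp).1 h1

end Solve

namespace Poly

@[fun_prop]
theorem solve {α S : Type} [Enc α] [Enc S] [DecidableEq S] {P : α → List S}
    {fin eve : α → S → Bool} {succ : α → S → List S} (hP : Poly P)
    (hfin : Poly (fun x : α × S => fin x.1 x.2)) (heve : Poly (fun x : α × S => eve x.1 x.2))
    (hsucc : Poly (fun x : α × S => succ x.1 x.2)) :
    Poly (fun x => solve (P x) (fin x) (eve x) (succ x)) := by
  obtain ⟨Q, hQ⟩ := hP.bound
  have hr : Poly (fun y : (α × List S) × S => (y.1.1, y.2)) := by fun_prop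
  have h1 : Poly (fun y : (α × List S) × S => fin y.1.1 y.2) := hfin.comp hr
  have h2 : Poly (fun y : (α × List S) × S => eve y.1.1 y.2) := heve.comp hr
  have h3 : Poly (fun y : (α × List S) × S => succ y.1.1 y.2) := hsucc.comp hr
  have hs : Poly (fun y : α × List S => solveStep (P y.1) (fin y.1) (eve y.1) (succ y.1) y.2) := by
    unfold solveStep
    fun_prop
  exact iterate_nat (n := fun x => (P x).length) (c := fun _ => [])
    (f := fun x X => solveStep (P x) (fin x) (eve x) (succ x) X) (by fun_prop) (by fun_prop) hs Q
    fun x j _ => (sz_le_of_sublist (iterate_solveStep_sublist_self j)).trans (hQ x)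

end Poly

/-! ### The decision procedure -/

section Rows

variable (rows : List (List Bool))

/-- The number of vertices. -/
def numV : ℕ := (rows.getD 0 []).length

/-- Whether Eve owns the vertex `v`. -/
def ownB (v : ℕ) : Bool := (rows.getD 0 []).getD v false

/-- Whether there is an edge from `u` to `v`. -/
def edgeB (u v : ℕ) : Bool := (rows.getD (u + 2) []).getD v false

/-- The successors of `v`. -/
def succs (v : ℕ) : List ℕ := (List.range (numV rows)).filter fun w => edgeB rows v w

/-- The positions of the entries `true` in a row. -/
def support (n : ℕ) (r : List Bool) : List ℕ := (List.range n).filter fun v => r.getD v false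

/-- The start vertex. -/
def startV : ℕ := (support (numV rows) (rows.getD 1 [])).getD 0 0

/-- The target sets. -/
def targetSets : List (List ℕ) := (rows.drop (numV rows + 2)).map fun r => support (numV rows) r

/-- The vertices whose singletons are target sets. -/
def singles : List ℕ := (List.range (numV rows)).filter fun v => memB [v] (targetSets rows)

/-- The target sets that are not singletons. -/
def nonSingles : List (List ℕ) := (targetSets rows).filter fun F => !eqB F.length 1

/-- Whether Eve can force a visit to `v` from `u`. -/
def forcesB (u v : ℕ) : Bool :=
  -- Adding `u` makes the answer correct for every natural number, also outside the range of
  -- vertices, as `reachAll_iff_reachChain` requires of the forcing relation.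
  memB u (solve (u :: List.range (numV rows)) (fun p => eqB p v) (fun p => ownB rows p)
    (fun p => succs rows p))

/-- The singletons that remain to be visited after a visit of `w`. -/
def visitB (w : ℕ) (Q : List ℕ) : List ℕ :=
  visit (singles rows) (fun u v => forcesB rows u v) w Q

/-- The positions of the game `reachChain`, where `sub` are the sublists of the target sets that are
not singletons. -/
def positions (sub : List (List (List ℕ))) : List (ℕ × List (List ℕ) × List ℕ) :=
  (List.range (numV rows)).flatMap fun v => sub.flatMap fun S =>
    (singles rows :: (List.range (numV rows)).map fun w =>
      (singles rows).filter fun u => !forcesB rows u w).map fun Q => (v, S, Q)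

/-- Whether Eve wins. -/
def winsB (sub : List (List (List ℕ))) : Bool :=
  memB (startV rows, unmet (startV rows) (nonSingles rows), visitB rows (startV rows) (singles rows))
    (solve (positions rows sub) (fun p => p.2.1.isEmpty && p.2.2.isEmpty) (fun p => ownB rows p.1)
      fun p => (succs rows p.1).map fun w => (w, unmet w p.2.1, visitB rows w p.2.2))

/-- The word that consists of the given rows. -/
def unparse : List (Option Bool) := rows.flatMap fun r => r.map some ++ [none]

/-- Whether the rows describe a game. -/
def validB : Bool :=
  (rows.all fun r => eqB r.length (numV rows)) && leB (numV rows + 2) rows.length &&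
  eqB (support (numV rows) (rows.getD 1 [])).length 1 &&
  (List.range (numV rows)).all fun u => (List.range (numV rows)).any fun v => edgeB rows u v

end Rows

/-- Add a symbol to the front of a list of rows. -/
def parseStep (rows : List (List Bool)) (x : Option Bool) : List (List Bool) :=
  optionCases x ([] :: rows) fun b => listCases rows [] fun r rs => (b :: r) :: rs

/-- The rows of a word. -/
def parse (w : List (Option Bool)) : List (List Bool) := w.reverse.foldl parseStep []

/-- The sublists of the target sets that are not singletons, if there are at most `c * log N` of
them. -/
def subsets (c N : ℕ) (F : List (List ℕ)) : List (List (List ℕ)) :=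
  (cond (leB F.length (c * Nat.log 2 N)) F []).sublists'

/-- Whether a word represents a game with few non-singletons that Eve wins. -/
def decideB (c : ℕ) (w : List (Option Bool)) : Bool :=
  -- `parse` is total and discards bits after the last separator; comparing with the re-encoded rows
  -- rejects such words.
  eqB (unparse (parse w)) w && validB (parse w) &&
  leB (nonSingles (parse w)).length (c * Nat.log 2 w.length) &&
  winsB (parse w) (subsets c w.length (nonSingles (parse w)))

/-! ### Polynomial running time of the decision procedure. -/

namespace Poly

variable {α : Type} [Enc α] {rows : α → List (List Bool)}

@[fun_prop]
theorem numV (h : Poly rows) : Poly (fun x => numV (rows x)) := by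
  unfold GenReach.numV
  fun_prop

@[fun_prop]
theorem ownB (h : Poly rows) {v : α → ℕ} (hv : Poly v) :
    Poly (fun x => ownB (rows x) (v x)) := by
  unfold GenReach.ownB
  fun_prop

@[fun_prop]
theorem edgeB (h : Poly rows) {u v : α → ℕ} (hu : Poly u) (hv : Poly v) :
    Poly (fun x => edgeB (rows x) (u x) (v x)) := by
  unfold GenReach.edgeB
  fun_prop

@[fun_prop]
theorem succs (h : Poly rows) {v : α → ℕ} (hv : Poly v) :
    Poly (fun x => succs (rows x) (v x)) := by
  unfold GenReach.succs
  fun_prop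

@[fun_prop]
theorem support {n : α → ℕ} {r : α → List Bool} (hn : Poly n) (hr : Poly r) :
    Poly (fun x => support (n x) (r x)) := by
  unfold GenReach.support
  fun_prop

@[fun_prop]
theorem startV (h : Poly rows) : Poly (fun x => startV (rows x)) := by
  unfold GenReach.startV
  fun_prop

@[fun_prop]
theorem targetSets (h : Poly rows) : Poly (fun x => targetSets (rows x)) := by
  unfold GenReach.targetSets
  fun_prop

@[fun_prop]
theorem singles (h : Poly rows) : Poly (fun x => singles (rows x)) := by
  unfold GenReach.singles
  fun_prop

@[fun_prop]
theorem nonSingles (h : Poly rows) : Poly (fun x => nonSingles (rows x)) := by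
  unfold GenReach.nonSingles
  fun_prop

@[fun_prop]
theorem forcesB (h : Poly rows) {u v : α → ℕ} (hu : Poly u) (hv : Poly v) :
    Poly (fun x => forcesB (rows x) (u x) (v x)) := by
  unfold GenReach.forcesB
  fun_prop

@[fun_prop]
theorem visitB (h : Poly rows) {w : α → ℕ} {Q : α → List ℕ} (hw : Poly w) (hQ : Poly Q) :
    Poly (fun x => visitB (rows x) (w x) (Q x)) := by
  unfold GenReach.visitB visit
  fun_prop

@[fun_prop]
theorem positions (h : Poly rows) {sub : α → List (List (List ℕ))} (hs : Poly sub) :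
    Poly (fun x => positions (rows x) (sub x)) := by
  unfold GenReach.positions
  fun_prop

@[fun_prop]
theorem unmet {w : α → ℕ} {R : α → List (List ℕ)} (hw : Poly w) (hR : Poly R) :
    Poly (fun x => unmet (w x) (R x)) := by
  unfold GenReach.unmet
  fun_prop

@[fun_prop]
theorem winsB (h : Poly rows) {sub : α → List (List (List ℕ))} (hs : Poly sub) :
    Poly (fun x => winsB (rows x) (sub x)) := by
  unfold GenReach.winsB
  fun_prop

@[fun_prop]
theorem some' {β : Type} [Enc β] {f : α → β} (hf : Poly f) : Poly (fun x => some (f x)) :=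
  (PolyTree.const_nil _).cons hf

@[fun_prop]
theorem unparse (h : Poly rows) : Poly (fun x => unparse (rows x)) := by
  unfold GenReach.unparse
  fun_prop

@[fun_prop]
theorem validB (h : Poly rows) : Poly (fun x => validB (rows x)) := by
  unfold GenReach.validB
  fun_prop

theorem sz_parseStep_le (rows : List (List Bool)) (x : Option Bool) :
    sz (parseStep rows x) ≤ sz rows + 4 := by
  rcases x with _ | b
  · simp only [parseStep, GenReach.optionCases, sz_cons, sz_nil]
    omega
  · rcases rows with _ | ⟨r, rs⟩
    · simp only [parseStep, GenReach.optionCases, GenReach.listCases]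
      omega
    · have : sz b ≤ 3 := by cases b <;> simp [sz, Enc.enc, T.size]
      simp only [parseStep, GenReach.optionCases, GenReach.listCases, sz_cons]
      omega

open Polynomial in
@[fun_prop]
theorem parse {w : α → List (Option Bool)} (hw : Poly w) : Poly (fun x => parse (w x)) := by
  have key (l : List (Option Bool)) (c : List (List Bool)) :
      sz (l.foldl parseStep c) ≤ sz c + 4 * l.length := by
    induction l generalizing c with
    | nil => exact le_rfl
    | cons a l ih =>
      have h1 := ih (parseStep c a)
      have h2 := sz_parseStep_le c a
      rw [List.foldl_cons, List.length_cons]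
      omega
  obtain ⟨P, hP⟩ := hw.bound
  unfold GenReach.parse
  refine foldl (l := fun x => (w x).reverse) (c := fun _ => []) (f := fun _ => parseStep)
    (by fun_prop) (by fun_prop) (by unfold parseStep; fun_prop) (C 4 * P + 1) fun x l₁ l₂ h => ?_
  refine (key _ _).trans ?_
  have h1 := hP x
  have h2 := length_lt_sz (w x)
  rw [← List.length_reverse, h, List.length_append] at h2
  simp only [sz_nil, eval_add, eval_mul, eval_C, eval_one]
  omega

open Polynomial in
@[fun_prop]
theorem subsets (c : ℕ) {w : α → List (Option Bool)} {F : α → List (List ℕ)} (hw : Poly w)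
    (hF : Poly F) : Poly (fun x => subsets c (w x).length (F x)) := by
  obtain ⟨P, hP⟩ := hw.bound
  unfold GenReach.subsets
  -- The list has length at most `c * Nat.log 2 N`, or is replaced by the empty list, so `2 ^ length
  -- ≤ (2 ^ Nat.log 2 N) ^ c`. The summand 1 covers the empty word. The guard in `subsets` is what
  -- makes the bound hold on all inputs.
  refine sublists' (by fun_prop) ((P + 1) ^ c) fun x => ?_
  have h1 : 2 ^ Nat.log 2 (w x).length ≤ P.eval (sz x) + 1 := by
    rcases Nat.eq_zero_or_pos (w x).length with h | h
    · simp [h]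
    · have := length_lt_sz (w x)
      have := hP x
      have := Nat.pow_log_le_self 2 h.ne'
      omega
  have h2 : (P.eval (sz x) + 1) ^ c = ((P + 1) ^ c).eval (sz x) := by simp
  rw [← h2]
  refine le_trans ?_ (Nat.pow_le_pow_left h1 c)
  rw [← pow_mul, mul_comm (Nat.log 2 (w x).length) c]
  refine Nat.pow_le_pow_right (by norm_num) ?_
  cases h : GenReach.leB (F x).length (c * Nat.log 2 (w x).length)
  · simp
  · simpa using h

theorem decideB (c : ℕ) : Poly (fun w => decideB c w) := by
  unfold GenReach.decideB
  fun_prop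

end Poly

theorem InP.of_decideB {L : Language (Option Bool)} (c : ℕ)
    (h : ∀ w, decideB c w = true ↔ w ∈ L) : InP L := by
  have hd := Poly.decideB c
  refine InP.of_poly_reverse (f := fun w => decideB c w.reverse) (by fun_prop) fun w => ?_
  rw [List.reverse_reverse]
  exact h w

/-! ### Correctness of the decision procedure -/

theorem parse_none_cons (w : List (Option Bool)) : parse (none :: w) = [] :: parse w := by
  simp [parse, List.foldl_reverse, parseStep, optionCases]

theorem parse_some_cons {w : List (Option Bool)} {r : List Bool} {rs : List (List Bool)}
    (h : parse w = r :: rs) (b : Bool) : parse (some b :: w) = (b :: r) :: rs := by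
  simp only [parse, List.foldl_reverse, List.foldr_cons] at h ⊢
  rw [h]
  rfl

theorem parse_unparse (rows : List (List Bool)) : parse (unparse rows) = rows := by
  induction rows with
  | nil => rfl
  | cons r rs ih =>
    have (w : List (Option Bool)) : parse (r.map some ++ none :: w) = r :: parse w := by
      induction r with
      | nil => exact parse_none_cons w
      | cons b r ih => exact parse_some_cons ih b
    have h := this (unparse rs)
    rw [ih] at h
    simpa [unparse] using h

section Rows

variable {rows : List (List Bool)}

theorem mem_succs {u v : ℕ} : v ∈ succs rows u ↔ v < numV rows ∧ edgeB rows u v = true := by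
  simp [succs]

theorem mem_support {n v : ℕ} {r : List Bool} :
    v ∈ support n r ↔ v < n ∧ r.getD v false = true := by
  simp [support]

theorem mem_singles {u : ℕ} : u ∈ singles rows ↔ [u] ∈ targetSets rows := by
  simp only [singles, List.mem_filter, List.mem_range, memB_eq, and_iff_right_iff_imp]
  intro h
  obtain ⟨r, -, h⟩ := List.mem_map.1 h
  have : u ∈ support (numV rows) r := by simp [h]
  exact (mem_support.1 this).1

variable (rows) in
/-- Eve's vertices. -/
abbrev rowsEve (v : ℕ) : Prop := ownB rows v = true

variable (rows) in
/-- The edge relation. -/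
abbrev rowsMove (u v : ℕ) : Prop := v ∈ succs rows u

theorem forcesB_iff (u v : ℕ) :
    forcesB rows u v = true ↔ (reachVertex (rowsEve rows) (rowsMove rows) v).Wins u := by
  unfold forcesB
  rw [memB_eq, mem_solve _ (by simp)]
  · refine (ReachGame.wins_iff_of_map id ?_ ?_ ?_ u).symm
    · simp [reachVertex, boolGame]
    · simp [reachVertex, boolGame]
    · simp [reachVertex, boolGame]
  · intro p _ q hq
    exact List.mem_cons_of_mem _ (List.mem_range.2 (mem_succs.1 hq).1)

theorem mem_positions {sub : List (List (List ℕ))} {v : ℕ} {S : List (List ℕ)} {Q : List ℕ} :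
    (v, S, Q) ∈ positions rows sub ↔ v < numV rows ∧ S ∈ sub ∧
      (Q = singles rows ∨ ∃ w < numV rows, Q = (singles rows).filter fun u => !forcesB rows u w) := by
  simp only [positions, List.mem_flatMap, List.mem_range, List.mem_map, List.mem_cons,
    Prod.mk.injEq]
  constructor
  · rintro ⟨v', hv, S', hS, Q', hQ, rfl, rfl, rfl⟩
    refine ⟨hv, hS, hQ.imp_right ?_⟩
    rintro ⟨w, hw, rfl⟩
    exact ⟨w, hw, rfl⟩
  · rintro ⟨hv, hS, hQ⟩
    refine ⟨v, hv, S, hS, Q, hQ.imp_right ?_, rfl, rfl, rfl⟩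
    rintro ⟨w, hw, rfl⟩
    exact ⟨w, hw, rfl⟩

/-- This is the polynomial bound on singleton sets: `visit` returns its argument or a filter of
`singles rows` indexed by `w`, so `positions` is closed under moves. -/
theorem visit_mem_positions {sub : List (List (List ℕ))} {w : ℕ} {S : List (List ℕ)}
    {Q : List ℕ} (hw : w < numV rows)
    (hQ : Q = singles rows ∨ ∃ w < numV rows, Q = (singles rows).filter fun u => !forcesB rows u w)
    (hS : S ∈ sub) : (w, S, visitB rows w Q) ∈ positions rows sub := by
  refine mem_positions.2 ⟨hw, hS, ?_⟩
  unfold visitB visit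
  cases memB w Q && Q.all (fun v => forcesB rows w v)
  · exact hQ
  · exact .inr ⟨w, hw, rfl⟩

theorem winsB_iff (hs : startV rows < numV rows) :
    winsB rows (nonSingles rows).sublists' = true ↔
      (reachAll (rowsEve rows) (rowsMove rows)).Wins
        (startV rows, unmet (startV rows) (targetSets rows)) := by
  rw [reachAll_iff_reachChain (f := fun u v => forcesB rows u v) forcesB_iff _
    (fun _ => mem_singles)]
  unfold winsB
  rw [memB_eq, mem_solve]
  · refine (ReachGame.wins_iff_of_map id ?_ ?_ ?_ _).symm
    · simp [reachChain, boolGame]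
    · simp [reachChain, boolGame]
    · rintro ⟨v, S, Q⟩ ⟨w, S', Q'⟩
      simp only [reachChain, boolGame, id, exists_eq_right, List.mem_map]
      constructor
      · rintro ⟨hw, rfl, rfl⟩
        exact ⟨w, hw, rfl⟩
      · rintro ⟨w', hw, h⟩
        simp only [Prod.mk.injEq] at h
        obtain ⟨rfl, rfl, rfl⟩ := h
        exact ⟨hw, rfl, rfl⟩
  · rintro ⟨v, S, Q⟩ hp q hq
    obtain ⟨w, hw, rfl⟩ := List.mem_map.1 hq
    obtain ⟨_, hS, hQ⟩ := mem_positions.1 hp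
    exact visit_mem_positions (mem_succs.1 hw).1 hQ
      (List.mem_sublists'.2 (List.filter_sublist.trans (List.mem_sublists'.1 hS)))
  · exact visit_mem_positions hs (.inl rfl) (List.mem_sublists'.2 List.filter_sublist)

theorem subsets_of_le {c N : ℕ} {F : List (List ℕ)} (h : F.length ≤ c * Nat.log 2 N) :
    subsets c N F = F.sublists' := by
  unfold subsets
  rw [(leB_eq _ _).2 h, cond_true]

end Rows

/-! ### The rows of a game -/

namespace Game

variable {n : ℕ} (G : Game (Fin n))

theorem encode_eq : G.encode = unparse G.rows := rfl

theorem numV_rows : numV G.rows = n := by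
  simp [numV, rows]

theorem getD_ofFn (f : Fin n → Bool) (v : Fin n) : (List.ofFn f).getD v false = f v := by
  simp [List.getD]

theorem ownB_rows (v : Fin n) : ownB G.rows v = true ↔ G.owner v = .eve := by
  have : ownB G.rows v = (G.owner v).toBit := getD_ofFn _ v
  rw [this]
  cases G.owner v <;> simp [Player.toBit]

theorem edgeB_rows (u v : Fin n) : edgeB G.rows u v = true ↔ (u, v) ∈ G.edges := by
  have h : G.rows.getD (u + 2) [] = List.ofFn fun v => decide ((u, v) ∈ G.edges) := by
    simp [rows, List.getD, List.getElem?_append_left]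
  unfold edgeB
  rw [h, getD_ofFn, decide_eq_true_eq]

theorem mem_succs_rows (u : Fin n) (w : ℕ) :
    w ∈ succs G.rows u ↔ ∃ v : Fin n, (u, v) ∈ G.edges ∧ v.val = w := by
  rw [mem_succs, numV_rows]
  constructor
  · rintro ⟨h, hw⟩
    exact ⟨⟨w, h⟩, (G.edgeB_rows u ⟨w, h⟩).1 hw, rfl⟩
  · rintro ⟨v, h, rfl⟩
    exact ⟨v.isLt, (G.edgeB_rows u v).2 h⟩

/-- The elements of a set of vertices in increasing order. -/
def elems (F : Finset (Fin n)) : List ℕ := support n (List.ofFn fun v => decide (v ∈ F))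

variable {G}

theorem mem_elems {F : Finset (Fin n)} {v : Fin n} : v.val ∈ elems F ↔ v ∈ F := by
  rw [elems, mem_support, getD_ofFn, decide_eq_true_eq]
  exact and_iff_right v.isLt

theorem length_elems (F : Finset (Fin n)) : (elems F).length = F.card := by
  have h : (elems F).toFinset = F.map Fin.valEmbedding := by
    ext v
    simp only [List.mem_toFinset, Finset.mem_map, Fin.valEmbedding_apply]
    constructor
    · intro h
      exact ⟨⟨v, (mem_support.1 h).1⟩, mem_elems.1 h, rfl⟩
    · rintro ⟨u, hu, rfl⟩
      exact mem_elems.2 hu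
  rw [← F.card_map Fin.valEmbedding, ← h, List.toFinset_card_of_nodup]
  exact List.nodup_range.filter _

variable (G)

theorem targetSets_rows : targetSets G.rows = G.targets.map elems := by
  have h : G.rows.drop (n + 2) =
      G.targets.map (fun F => List.ofFn (fun v => decide (v ∈ F))) := by
    simp [rows]
  unfold targetSets
  rw [numV_rows, h, List.map_map]
  rfl

theorem support_start : support n (G.rows.getD 1 []) = [G.start.val] := by
  have h : support n (G.rows.getD 1 []) = elems {G.start} := by
    simp [rows, elems]
  obtain ⟨u, hu⟩ := List.length_eq_one_iff.1 (length_elems {G.start})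
  have := (mem_elems (F := {G.start}) (v := G.start)).2 (by simp)
  rw [hu, List.mem_singleton] at this
  rw [h, hu, this]

theorem startV_rows : startV G.rows = G.start := by
  unfold startV
  rw [numV_rows, support_start]
  rfl

theorem length_nonSingles_rows : (nonSingles G.rows).length = G.numNonSingleton := by
  unfold nonSingles numNonSingleton
  rw [targetSets_rows, List.filter_map, List.length_map]
  congr 2
  funext F
  simp [eqB, length_elems]

theorem unmet_elems (w : Fin n) (R : List (Finset (Fin n))) :
    unmet w.val (R.map elems) = (R.filter fun F => w ∉ F).map elems := by
  unfold unmet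
  rw [List.filter_map]
  congr 2
  funext F
  simp [memB, mem_elems]

/-- Passing from `Fin n` and finite sets to numbers and lists is a bisimulation, because `elems`
commutes with the removal of visited targets (`unmet_elems`). -/
theorem wins_remaining_iff (v : Fin n) (R : List (Finset (Fin n))) :
    (reachAll (rowsEve G.rows) (rowsMove G.rows)).Wins (v.val, R.map elems) ↔
      G.remaining.Wins (v, R) := by
  refine ReachGame.wins_iff_of_map (fun p : Fin n × List (Finset (Fin n)) =>
    (p.1.val, p.2.map elems)) (fun p => ?_) (fun p => G.ownB_rows p.1) (fun p q' => ?_) (v, R)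
  · simp [reachAll, remaining]
  · obtain ⟨w, R'⟩ := q'
    simp only [reachAll, remaining, rowsMove, mem_succs_rows]
    constructor
    · rintro ⟨⟨w, hw, rfl⟩, rfl⟩
      refine ⟨(w, p.2.filter fun F => w ∉ F), ⟨hw, by simp⟩, ?_⟩
      rw [Prod.mk.injEq]
      refine ⟨rfl, ?_⟩
      exact (unmet_elems w p.2).symm
    · rintro ⟨⟨w, R''⟩, ⟨hw, hR⟩, h⟩
      obtain ⟨rfl, rfl⟩ := Prod.mk.inj h
      refine ⟨⟨w, hw, rfl⟩, ?_⟩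
      simp only at hR ⊢
      rw [hR]
      refine Eq.trans ?_ (unmet_elems w p.2).symm
      congr 2
      funext F
      simp

theorem winsB_rows :
    winsB G.rows (nonSingles G.rows).sublists' = true ↔ G.EveWins := by
  rw [winsB_iff (by rw [startV_rows, numV_rows]; exact G.start.isLt), G.eveWins_iff,
    ← wins_remaining_iff, startV_rows, targetSets_rows, unmet_elems]
  unfold unvisited
  simp

theorem validB_rows : validB G.rows = true := by
  unfold validB
  rw [numV_rows, support_start]
  simp only [Bool.and_eq_true, List.all_eq_true, List.any_eq_true, eqB_eq, leB_eq, List.mem_range]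
  refine ⟨⟨⟨?_, by simp [rows]⟩, rfl⟩, fun u hu => ?_⟩
  · intro r hr
    simp only [rows, List.mem_cons, List.mem_append, List.mem_ofFn, List.mem_map] at hr
    rcases hr with rfl | rfl | ⟨u, rfl⟩ | ⟨F, -, rfl⟩ <;> simp
  · obtain ⟨v, hv⟩ := G.exists_succ ⟨u, hu⟩
    exact ⟨v, v.isLt, (G.edgeB_rows ⟨u, hu⟩ v).2 hv⟩

end Game

theorem exists_game {rows : List (List Bool)} (h : validB rows = true) :
    ∃ (n : ℕ) (G : Game (Fin n)), G.rows = rows := by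
  simp only [validB, Bool.and_eq_true, List.all_eq_true, List.any_eq_true, eqB_eq, leB_eq,
    List.mem_range] at h
  obtain ⟨⟨⟨h1, h2⟩, h3⟩, h4⟩ := h
  obtain ⟨s, hs⟩ := List.length_eq_one_iff.1 h3
  -- Validity gives the second row exactly one entry `true`, so it is the indicator vector of `s`.
  have hs' (v : ℕ) (hv : v < numV rows) : (rows.getD 1 []).getD v false = decide (v = s) := by
    have := mem_support (n := numV rows) (v := v) (r := rows.getD 1 [])
    rw [hs, List.mem_singleton] at this
    rw [Bool.eq_iff_iff, decide_eq_true_eq, this]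
    exact (and_iff_right hv).symm
  have hsn : s < numV rows := by
    have : s ∈ support (numV rows) (rows.getD 1 []) := by rw [hs]; simp
    exact (mem_support.1 this).1
  have hrow {r : List Bool} (hr : r ∈ rows) {f : Fin (numV rows) → Bool}
      (hf : ∀ v, f v = r.getD v false) : List.ofFn f = r := by
    have hl := h1 r hr
    refine List.ext_getElem (by simp [hl]) fun i hi hi' => ?_
    rw [List.getElem_ofFn, hf, List.getD_eq_getElem _ _ hi']
  have hmem {i : ℕ} (hi : i < numV rows + 2) : rows.getD i [] ∈ rows := by
    rw [List.getD_eq_getElem _ _ (by omega)]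
    exact List.getElem_mem _
  refine ⟨numV rows, {
    edges := Finset.univ.filter fun p => edgeB rows p.1 p.2 = true
    owner := fun v => cond (ownB rows v) .eve .adam
    exists_succ := fun v => ?_
    start := ⟨s, hsn⟩
    targets := (rows.drop (numV rows + 2)).map fun r =>
      Finset.univ.filter fun v : Fin (numV rows) => r.getD v false = true }, ?_⟩
  · obtain ⟨w, hw, h⟩ := h4 v v.isLt
    exact ⟨⟨w, hw⟩, by simpa using h⟩
  · have e : rows = rows.getD 0 [] :: rows.getD 1 [] ::
        (List.ofFn (fun u : Fin (numV rows) => rows.getD (u + 2) []) ++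
          rows.drop (numV rows + 2)) := by
      obtain ⟨a, b, t, rfl⟩ : ∃ a b t, rows = a :: b :: t := by
        rcases rows with _ | ⟨a, _ | ⟨b, t⟩⟩
        · simp at h2
        · simp at h2
        · exact ⟨a, b, t, rfl⟩
      have ht : numV (a :: b :: t) ≤ t.length := by simpa using h2
      have : List.ofFn (fun u : Fin (numV (a :: b :: t)) => t.getD u []) =
          t.take (numV (a :: b :: t)) := by
        refine List.ext_getElem (by simp [ht]) fun i hi hi' => ?_
        rw [List.length_ofFn] at hi
        rw [List.getElem_ofFn, List.getElem_take, List.getD_eq_getElem _ _ (by omega)]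
      simp only [List.getD_cons_zero, List.getD_cons_succ, List.drop_succ_cons, this,
        List.take_append_drop]
    conv_rhs => rw [e]
    unfold Game.rows
    congr 1
    · refine hrow (hmem (by omega)) fun v => ?_
      simp only [ownB]
      cases (rows.getD 0 []).getD v false <;> rfl
    · congr 1
      · refine hrow (hmem (by omega)) fun v => ?_
        rw [hs' v v.isLt]
        simp [Fin.ext_iff]
      · congr 1
        · congr 1
          funext u
          refine hrow (hmem (by omega)) fun v => ?_
          simp [edgeB]
        · simp only [List.map_map]
          refine (List.map_congr_left fun r hr => ?_).trans (List.map_id _)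
          refine hrow (List.mem_of_mem_drop hr) fun v => ?_
          simp

theorem decideB_rows {n : ℕ} (G : Game (Fin n)) (c : ℕ) : decideB c G.encode = true ↔
    G.numNonSingleton ≤ c * Nat.log 2 G.size ∧ G.EveWins := by
  unfold decideB
  rw [show parse G.encode = G.rows from parse_unparse _]
  simp only [Bool.and_eq_true, eqB_eq, leB_eq, G.validB_rows, ← G.encode_eq, true_and,
    G.length_nonSingles_rows]
  refine and_congr_right fun h => ?_
  rw [subsets_of_le (by rwa [G.length_nonSingles_rows]), G.winsB_rows]

theorem decideB_iff (c : ℕ) (w : List (Option Bool)) : decideB c w = true ↔ w ∈ logLanguage c := by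
  constructor
  · intro h
    have h' := h
    simp only [decideB, Bool.and_eq_true, eqB_eq] at h'
    obtain ⟨n, G, hG⟩ := exists_game h'.1.1.2
    have hw : w = G.encode := by rw [G.encode_eq, hG, h'.1.1.1]
    rw [hw, decideB_rows] at h
    exact ⟨n, G, hw, h⟩
  · rintro ⟨n, G, rfl, h⟩
    exact (decideB_rows G c).2 h

end GenReach

/-! ### Logarithmic bounds and the main theorem. -/

open GenReach in
theorem GenReach.Game.two_le_size {n : ℕ} (G : Game (Fin n)) : 2 ≤ G.size := by
  have := G.start.isLt
  simp only [Game.size, Game.encode, Game.rows, List.flatMap_cons, List.length_append,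
    List.length_map, List.length_cons, List.length_nil]
  omega

theorem GenReach.exists_le_mul_log {k : ℕ → ℕ}
    (hk : Asymptotics.IsBigO Filter.atTop (fun N => (k N : ℝ)) (fun N => Real.log (N : ℝ))) :
    ∃ c : ℕ, ∀ N, 2 ≤ N → k N ≤ c * Nat.log 2 N := by
  obtain ⟨C, hC⟩ := hk.bound
  obtain ⟨M, hM⟩ := Filter.eventually_atTop.1 hC
  -- The first summand serves `N ≥ M`, where `Real.log N ≤ 2 * Nat.log 2 N`; the second bounds the
  -- finitely many smaller values and uses `1 ≤ Nat.log 2 N`.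
  refine ⟨2 * ⌈C⌉₊ + (Finset.range M).sup k, fun N hN => ?_⟩
  have h1 : 1 ≤ Nat.log 2 N := Nat.log_pos (by norm_num) hN
  rw [add_mul]
  rcases lt_or_ge N M with h | h
  · have h2 : k N ≤ (Finset.range M).sup k := Finset.le_sup (Finset.mem_range.2 h)
    exact (h2.trans (Nat.le_mul_of_pos_right _ h1)).trans (Nat.le_add_left _ _)
  · refine le_trans ?_ (Nat.le_add_right _ _)
    have h2 := hM N h
    have hN' : (1 : ℝ) ≤ N := by exact_mod_cast (by omega : 1 ≤ N)
    have h3 : Real.log N ≤ 2 * Nat.log 2 N := by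
      have h4 : (N : ℝ) ≤ 2 ^ (Nat.log 2 N + 1) := by
        exact_mod_cast (Nat.lt_pow_succ_log_self (by norm_num) N).le
      have h5 := Real.log_le_log (by linarith) h4
      rw [Real.log_pow] at h5
      have h6 : Real.log 2 ≤ 1 := Real.log_two_lt_d9.le.trans (by norm_num)
      have h7 : (1 : ℝ) ≤ Nat.log 2 N := by exact_mod_cast h1
      have h8 : ((Nat.log 2 N + 1 : ℕ) : ℝ) * Real.log 2 ≤ (Nat.log 2 N + 1 : ℕ) * 1 :=
        mul_le_mul_of_nonneg_left h6 (Nat.cast_nonneg _)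
      push_cast at h5 h8
      linarith
    rw [Real.norm_of_nonneg (Nat.cast_nonneg _), Real.norm_of_nonneg (Real.log_nonneg hN')] at h2
    have h9 : (k N : ℝ) ≤ ⌈C⌉₊ * (2 * Nat.log 2 N) :=
      h2.trans (mul_le_mul (Nat.le_ceil C) h3 (Real.log_nonneg hN') (Nat.cast_nonneg _))
    have : (k N : ℝ) ≤ ((2 * ⌈C⌉₊ * Nat.log 2 N : ℕ) : ℝ) := by
      push_cast
      linarith
    exact_mod_cast this

theorem mainTheorem9 :
    (∀ c : ℕ, GenReach.InP (GenReach.logLanguage c)) ∧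
    (∀ k : ℕ → ℕ,
      Asymptotics.IsBigO Filter.atTop (fun N => (k N : ℝ)) (fun N => Real.log (N : ℝ)) →
      ∃ L : Language (Option Bool), GenReach.InP L ∧
        ∀ (n : ℕ) (G : GenReach.Game (Fin n)),
          G.numNonSingleton ≤ k G.size → (G.encode ∈ L ↔ G.EveWins)) := by
  have h1 (c : ℕ) : GenReach.InP (GenReach.logLanguage c) :=
    GenReach.InP.of_decideB c (GenReach.decideB_iff c)
  refine ⟨h1, fun k hk => ?_⟩
  obtain ⟨c, hc⟩ := GenReach.exists_le_mul_log hk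
  refine ⟨GenReach.logLanguage c, h1 c, fun n G hG => ?_⟩
  rw [← GenReach.decideB_iff, GenReach.decideB_rows]
  exact and_iff_right (hG.trans (hc _ G.two_le_size))
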